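/- Let $r=q/p$ be a rational number in lowest terms, $p\ge 1$, with $q\not\equiv\pm1\pmod p$. Let $K(r)\subset S^3$ be the (then hyperbolic) $2$-bridge link of slope $r$, i.e. $(S^3,K(r))$ is the union of the rational tangles of slopes $\infty$ and $r$ glued along the Conway sphere $(\mathbb R^2,\mathbb Z^2)/\mathcal J$, where $\mathcal J$ is the group generated by the $\pi$-rotations about the points of $\mathbb Z^2$. Let $\tau_+$ and $\tau_-$ be the core arcs of these two tangles (the upper and lower tunnels), and let $G(r)=\pi_1(S^3-K(r))$. A strong inversion of a link $K\subset S^3$ is an orientation-preserving involution $h$ of $S^3$ with $h(K)=K$ whose fixed point set is a circle meeting each component of $K$ in exactly two points. A strong inversion $h$ of $K(r)$ is called extra if it is pairwise isotopic to a homeomorphism of $(S^3,K(r))$ that interchanges $\tau_+$ and $\tau_-$. A tunnel is an arc $\tau$ in $S^3$ meeting the link exactly in $\partial\tau$; it determines a pair of meridians of the link group, up to inverting each of them and simultaneous conjugation. An extra meridian pair of $G(r)$ is a meridian pair $\{m_1,m_2\}$ determined by a tunnel for $K(r)$ contained in $\operatorname{Fix}(h)$ for some extra strong inversion $h$ of $K(r)$.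 Let $M(K(r))$ be the double branched covering of $S^3$ branched over $K(r)$, and let $O(r)$ be the quotient of $G(r)$ by the normal closure of the squares of the meridians. Then $O(r)=\pi_1(M(K(r)))\rtimes\mathbb Z_2$, where $\pi_1(M(K(r)))$ is the kernel of the homomorphism $O(r)\to\mathbb Z_2$ sending every meridian to the generator. The image of $m_1m_2$ in $O(r)$ lies in this kernel; let $\omega(m_1,m_2)$ be its class in $H_1(M(K(r)))=\pi_1(M(K(r)))^{\mathrm{ab}}$. Proposition. For every extra meridian pair $\{m_1,m_2\}$ of $G(r)$, the element $\omega(m_1,m_2)$ does not generate the group $H_1(M(K(r)))$. -/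

import Mathlib

open scoped unitInterval

noncomputable section

namespace TwoBridge

/-! ## The pair `(S³, K(r))` as a union of two rational tangles -/

/-- Two vectors of the plane are related if they lie in one orbit of the group `𝒥` generated by the
`π`-rotations about the points of `ℤ²`, i.e. of the group of all maps `v ↦ ± v + 2n`, `n ∈ ℤ²`.
The quotient of `(ℝ², ℤ²)` by this relation is the Conway sphere (a sphere with four marked
points). -/
def PillowRel (v w : ℝ × ℝ) : Prop :=
  ∃ a b : ℤ, w = (v.1 + 2 * a, v.2 + 2 * b) ∨ w = (2 * a - v.1, 2 * b - v.2)

/-- Two vectors are related if their images in the Conway sphere lie on the image of one line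
parallel to the vector `d`. -/
def LeafRel (d v w : ℝ × ℝ) : Prop :=
  ∃ c : ℝ, PillowRel (v.1 + c * d.1, v.2 + c * d.2) w

/-- The direction `(0, 1)` of the lines of slope `∞`. -/
def dirInfty : ℝ × ℝ := (0, 1)

/-- The direction `(p, q)` of the lines of slope `r = q / p`. -/
def dirSlope (r : ℚ) : ℝ × ℝ := ((r.den : ℝ), (r.num : ℝ))

/-- The gluing on `ℝ² × [0, 1]`: at every height `t` one divides by the group `𝒥`; at `t = 0` one
moreover collapses every line of slope `∞` to a point, and at `t = 1` every line of slope `r`. -/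
def GlueRel (r : ℚ) (x y : (ℝ × ℝ) × I) : Prop :=
  x.2 = y.2 ∧ (PillowRel x.1 y.1 ∨ (x.2 = 0 ∧ LeafRel dirInfty x.1 y.1) ∨
    (x.2 = 1 ∧ LeafRel (dirSlope r) x.1 y.1))

theorem PillowRel.refl (v : ℝ × ℝ) : PillowRel v v := ⟨0, 0, Or.inl (by simp)⟩

theorem PillowRel.symm {v w : ℝ × ℝ} (h : PillowRel v w) : PillowRel w v := by
  obtain ⟨a, b, rfl | rfl⟩ := h
  · exact ⟨-a, -b, Or.inl (by ext <;> push_cast <;> ring)⟩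
  · exact ⟨a, b, Or.inr (by ext <;> push_cast <;> ring)⟩

theorem PillowRel.trans {u v w : ℝ × ℝ} (h : PillowRel u v) (k : PillowRel v w) :
    PillowRel u w := by
  obtain ⟨a, b, rfl | rfl⟩ := h <;> obtain ⟨a', b', rfl | rfl⟩ := k
  · exact ⟨a + a', b + b', Or.inl (by ext <;> push_cast <;> ring)⟩
  · exact ⟨a' - a, b' - b, Or.inr (by ext <;> push_cast <;> ring)⟩
  · exact ⟨a + a', b + b', Or.inr (by ext <;> push_cast <;> ring)⟩
  · exact ⟨a' - a, b' - b, Or.inl (by ext <;> push_cast <;> ring)⟩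

theorem LeafRel.symm {d v w : ℝ × ℝ} (h : LeafRel d v w) : LeafRel d w v := by
  obtain ⟨c, a, b, rfl | rfl⟩ := h
  · exact ⟨-c, -a, -b, Or.inl (by ext <;> push_cast <;> ring)⟩
  · exact ⟨c, a, b, Or.inr (by ext <;> push_cast <;> ring)⟩

theorem LeafRel.trans {d u v w : ℝ × ℝ} (h : LeafRel d u v) (k : LeafRel d v w) :
    LeafRel d u w := by
  obtain ⟨c, a, b, rfl | rfl⟩ := h <;> obtain ⟨c', a', b', rfl | rfl⟩ := k
  · exact ⟨c + c', a + a', b + b', Or.inl (by ext <;> push_cast <;> ring)⟩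
  · exact ⟨c + c', a' - a, b' - b, Or.inr (by ext <;> push_cast <;> ring)⟩
  · exact ⟨c - c', a + a', b + b', Or.inr (by ext <;> push_cast <;> ring)⟩
  · exact ⟨c - c', a' - a, b' - b, Or.inl (by ext <;> push_cast <;> ring)⟩

theorem PillowRel.leaf {d v w : ℝ × ℝ} (h : PillowRel v w) : LeafRel d v w :=
  ⟨0, by simpa using h⟩

theorem glueRel_equivalence (r : ℚ) : Equivalence (GlueRel r) where
  refl x := ⟨rfl, Or.inl (PillowRel.refl _)⟩
  symm := by
    rintro x y ⟨h, k⟩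
    refine ⟨h.symm, ?_⟩
    rcases k with k | ⟨e, k⟩ | ⟨e, k⟩
    · exact Or.inl k.symm
    · exact Or.inr (Or.inl ⟨h ▸ e, k.symm⟩)
    · exact Or.inr (Or.inr ⟨h ▸ e, k.symm⟩)
  trans := by
    rintro x y z ⟨h, k⟩ ⟨h', k'⟩
    refine ⟨h.trans h', ?_⟩
    rcases k with k | ⟨e, k⟩ | ⟨e, k⟩ <;> rcases k' with k' | ⟨e', k'⟩ | ⟨e', k'⟩
    · exact Or.inl (k.trans k')
    · exact Or.inr (Or.inl ⟨h.trans e', k.leaf.trans k'⟩)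
    · exact Or.inr (Or.inr ⟨h.trans e', k.leaf.trans k'⟩)
    · exact Or.inr (Or.inl ⟨e, k.trans k'.leaf⟩)
    · exact Or.inr (Or.inl ⟨e, k.trans k'⟩)
    · exact absurd (e.symm.trans (h.trans e')) zero_ne_one
    · exact Or.inr (Or.inr ⟨e, k.trans k'.leaf⟩)
    · exact absurd (e.symm.trans (h.trans e')) one_ne_zero
    · exact Or.inr (Or.inr ⟨e, k.trans k'⟩)

/-- The equivalence relation `GlueRel r` as a setoid. -/
def glueSetoid (r : ℚ) : Setoid ((ℝ × ℝ) × I) := ⟨GlueRel r, glueRel_equivalence r⟩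

/-- The union of the rational tangles of slopes `∞` and `r` along their common boundary, the Conway
sphere at height `t = 1/2`.  The half `t ≤ 1/2` is a ball in which every loop of slope `∞` on the
Conway sphere bounds a disc disjoint from the strings (shrink it along the height to a point at
`t = 0`); the half `t ≥ 1/2` is a ball in which every loop of slope `r` does.  The union is a
`3`-sphere. -/
def TangleUnion (r : ℚ) : Type := Quotient (glueSetoid r)

instance (r : ℚ) : TopologicalSpace (TangleUnion r) :=
  inferInstanceAs (TopologicalSpace (Quotient (glueSetoid r)))

/-- The point of the tangle union represented by a point of `ℝ² × [0, 1]`. -/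
def TangleUnion.mk (r : ℚ) (x : (ℝ × ℝ) × I) : TangleUnion r :=
  Quotient.mk (glueSetoid r) x

/-- The union of the strings of the two rational tangles: the image of `ℤ² × [0, 1]`. -/
def stringsUnion (r : ℚ) : Set (TangleUnion r) :=
  {z | ∃ (a b : ℤ) (t : I), z = TangleUnion.mk r (((a : ℝ), (b : ℝ)), t)}

/-- The core arc of the rational tangle of slope `∞` (the space of leaves of slope `∞`),
which joins the two strings of that tangle. -/
def coreInfty (r : ℚ) : Set (TangleUnion r) := {z | ∃ v : ℝ × ℝ, z = TangleUnion.mk r (v, 0)}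

/-- The core arc of the rational tangle of slope `r`. -/
def coreSlope (r : ℚ) : Set (TangleUnion r) := {z | ∃ v : ℝ × ℝ, z = TangleUnion.mk r (v, 1)}

/-- The `3`-sphere. -/
abbrev S3 : Type := Metric.sphere (0 : EuclideanSpace ℝ (Fin 4)) 1

/-- A `2`-bridge link of slope `r` in `S³`, given with its decomposition into the rational tangles
of slopes `∞` and `r`. -/
structure TwoBridgeLink (r : ℚ) where
  /-- The identification of the union of the two tangles with `S³`. -/
  homeo : TangleUnion r ≃ₜ S3

variable {r : ℚ}

/-- The link `K(r) ⊆ S³`. -/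
def TwoBridgeLink.link (L : TwoBridgeLink r) : Set S3 := L.homeo '' stringsUnion r

/-- The upper tunnel `τ₊` of `K(r)`. -/
def TwoBridgeLink.upperTunnel (L : TwoBridgeLink r) : Set S3 := L.homeo '' coreInfty r

/-- The lower tunnel `τ₋` of `K(r)`. -/
def TwoBridgeLink.lowerTunnel (L : TwoBridgeLink r) : Set S3 := L.homeo '' coreSlope r

/-- The condition `q ≢ ± 1 (mod p)` on `r = q / p` (in lowest terms, `p ≥ 1`) characterising the
hyperbolic `2`-bridge links. -/
def IsHyperbolicSlope (r : ℚ) : Prop :=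
  ¬ r.num ≡ 1 [ZMOD (r.den : ℤ)] ∧ ¬ r.num ≡ -1 [ZMOD (r.den : ℤ)]

/-! ## Link groups, meridians and tunnels -/

section Pair

variable {X : Type} [TopologicalSpace X] (K : Set X)

/-- The link group `π₁(X - K, b)`. -/
abbrev LinkGroup (b : (Kᶜ : Set X)) : Type := FundamentalGroup (Kᶜ : Set X) b

/-- A chart of `X` onto `ℂ × ℝ` that carries (the part in its domain of) `K` onto `{0} × ℝ`. -/
structure StraighteningChart where
  /-- The underlying chart. -/
  chart : OpenPartialHomeomorph X (ℂ × ℝ)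
  target_eq : chart.target = Set.univ
  mem_iff : ∀ x ∈ chart.source, x ∈ K ↔ (chart x).1 = 0

variable {K}

/-- The loop at `c ∉ K` which, in a straightening chart, runs once round the axis `{0} × ℝ`
along the circle through `c` centred on the axis. -/
def StraighteningChart.loop (e : StraighteningChart K) (c : (Kᶜ : Set X))
    (hc : (c : X) ∈ e.chart.source) : Path c c where
  toFun u := ⟨e.chart.symm
      (Complex.exp (2 * Real.pi * Complex.I * (u : ℝ)) * (e.chart c).1, (e.chart c).2), by
    have ht : ∀ y, y ∈ e.chart.target := fun y => e.target_eq ▸ Set.mem_univ y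
    intro h
    rw [e.mem_iff _ (e.chart.map_target (ht _)), e.chart.right_inv (ht _)] at h
    rcases mul_eq_zero.mp h with h | h
    · exact Complex.exp_ne_zero _ h
    · exact c.2 ((e.mem_iff _ hc).mpr h)⟩
  continuous_toFun := by
    refine Continuous.subtype_mk ?_ _
    have h := e.chart.continuousOn_symm
    rw [e.target_eq, continuousOn_univ] at h
    exact h.comp (by fun_prop)
  source' := by
    apply Subtype.ext
    simp [e.chart.left_inv hc]
  target' := by
    apply Subtype.ext
    simp [Complex.exp_two_pi_mul_I, e.chart.left_inv hc]

/-- The element of the link group represented by the lasso that runs along `β`, once round `K`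
in the chart `e`, and back along `β`. -/
def lasso {b c : (Kᶜ : Set X)} (e : StraighteningChart K) (hc : (c : X) ∈ e.chart.source)
    (β : Path b c) : LinkGroup K b :=
  FundamentalGroup.fromPath ⟦(β.trans (e.loop c hc)).trans β.symm⟧

/-- The meridians: the elements of the link group that are freely homotopic to a small loop
running once (in either direction) round `K`. -/
def IsMeridian {b : (Kᶜ : Set X)} (m : LinkGroup K b) : Prop :=
  ∃ (c : (Kᶜ : Set X)) (e : StraighteningChart K) (hc : (c : X) ∈ e.chart.source) (β : Path b c),
    m = lasso e hc β

variable (K)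

/-- A tunnel (parametrised): an arc in `X` that meets `K` exactly in its end points. -/
structure Tunnel where
  /-- The parametrisation. -/
  arc : C(I, X)
  injective : Function.Injective arc
  mem_iff : ∀ t, arc t ∈ K ↔ t = 0 ∨ t = 1

variable {K}

/-- The point of a tunnel with an interior parameter, as a point off `K`. -/
def Tunnel.point (τ : Tunnel K) (s : Set.Ioo (0 : I) 1) : (Kᶜ : Set X) :=
  ⟨τ.arc s, fun h => (((τ.mem_iff _).mp h).elim s.2.1.ne' s.2.2.ne)⟩

/-- The segment of a tunnel between two interior parameters `s ≤ s'`, as a path off `K`. -/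
def Tunnel.segment (τ : Tunnel K) (s s' : Set.Ioo (0 : I) 1) (hs : s ≤ s') :
    Path (τ.point s) (τ.point s') where
  toFun u := ⟨τ.arc (Set.projIcc (s : I) s' hs
      (Set.projIcc (0 : ℝ) 1 zero_le_one ((s : I) + (u : ℝ) * (((s' : I) : ℝ) - ((s : I) : ℝ))))),
    fun h => by
      have hm := (Set.projIcc (s : I) s' hs (Set.projIcc (0 : ℝ) 1 zero_le_one
        ((s : I) + (u : ℝ) * (((s' : I) : ℝ) - ((s : I) : ℝ))))).2
      rcases (τ.mem_iff _).mp h with h | h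
      · exact absurd (s.2.1.trans_le hm.1) (by rw [h]; exact lt_irrefl _)
      · exact absurd (hm.2.trans_lt s'.2.2) (by rw [h]; exact lt_irrefl _)⟩
  continuous_toFun := by
    refine Continuous.subtype_mk (τ.arc.continuous.comp (continuous_subtype_val.comp
      (continuous_projIcc.comp (continuous_projIcc.comp (by fun_prop))))) _
  source' := by
    apply Subtype.ext
    simp [Tunnel.point]
  target' := by
    apply Subtype.ext
    simp [Tunnel.point]

/-- `(m₁, m₂)` is (a representative of) the meridian pair determined by the tunnel `τ`:
`m₁` is a lasso round `K` near the initial point of `τ`, and `m₂` is a lasso round `K` near the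
final point of `τ`, whose tails follow a common path `β` from the base point to a point of `τ`,
and then `τ` itself.
The chart used at either end contains the whole part of `τ` between the end point and
the place where the lasso leaves `τ`. -/
def Tunnel.Represents (τ : Tunnel K) {b : (Kᶜ : Set X)} (m₁ m₂ : LinkGroup K b) : Prop :=
  ∃ (s s' : Set.Ioo (0 : I) 1) (hs : s ≤ s') (e e' : StraighteningChart K)
    (he : ∀ t : I, t ≤ s → τ.arc t ∈ e.chart.source)
    (he' : ∀ t : I, (s' : I) ≤ t → τ.arc t ∈ e'.chart.source)
    (β : Path b (τ.point s)),
    m₁ = lasso e (he _ le_rfl) β ∧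
    m₂ = lasso e' (he' _ le_rfl) (β.trans (τ.segment s s' hs))

/-! ## The `π`-orbifold group and the homology of the double branched covering -/

variable (K) in
/-- The normal closure of the squares of the meridians. -/
def meridianSquares (b : (Kᶜ : Set X)) : Subgroup (LinkGroup K b) :=
  Subgroup.normalClosure {g | ∃ m : LinkGroup K b, IsMeridian m ∧ g = m ^ 2}

instance (b : (Kᶜ : Set X)) : (meridianSquares K b).Normal := Subgroup.normalClosure_normal

variable (K) in
/-- The `π`-orbifold group `O(K)`. -/
abbrev OrbifoldGroup (b : (Kᶜ : Set X)) : Type := LinkGroup K b ⧸ meridianSquares K b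

/-- The homomorphisms from `O(K)` to `ℤ/2` that send every meridian to the generator.  For a link
in `S³` there is exactly one; its kernel, pulled back to the link group, is the subgroup
corresponding to the double covering of the complement that extends to the double branched
covering. -/
def IsMeridional {b : (Kᶜ : Set X)} (ε : OrbifoldGroup K b →* Multiplicative (ZMod 2)) : Prop :=
  ∀ m : LinkGroup K b, IsMeridian m →
    ε (QuotientGroup.mk' (meridianSquares K b) m) = Multiplicative.ofAdd 1

variable (K) in
/-- The fundamental group of the double covering `M(K)` of `S³` branched over `K`, as the index `2`
subgroup in `O(K) = π₁(M(K)) ⋊ ℤ/2`: the kernel of the homomorphism to `ℤ/2` that sends every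
meridian to the generator.  (The fundamental group of the unbranched double covering is the kernel
of the corresponding homomorphism of the link group, and gluing in the branch set kills precisely
the lifts of the squares of the meridians.) -/
def doubleCoverGroup (b : (Kᶜ : Set X)) : Subgroup (OrbifoldGroup K b) :=
  ⨅ (ε : OrbifoldGroup K b →* Multiplicative (ZMod 2)) (_ : IsMeridional ε), ε.ker

variable (K) in
/-- The homology group `H₁(M(K))` (written multiplicatively): the abelianised fundamental group. -/
abbrev H1DoubleCover (b : (Kᶜ : Set X)) : Type := Abelianization (doubleCoverGroup K b)

/-- The product of two meridians lies in the subgroup `π₁(M(K))` of `O(K)`. -/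
theorem mul_mem_doubleCoverGroup {b : (Kᶜ : Set X)} {m₁ m₂ : LinkGroup K b}
    (h₁ : IsMeridian m₁) (h₂ : IsMeridian m₂) :
    QuotientGroup.mk' (meridianSquares K b) (m₁ * m₂) ∈ doubleCoverGroup K b := by
  simp only [doubleCoverGroup, Subgroup.mem_iInf]
  intro ε hε
  rw [MonoidHom.mem_ker, map_mul, map_mul, hε _ h₁, hε _ h₂]
  decide

/-- The element `ω(m₁, m₂)` of `H₁(M(K))`: the class of the element of `O(K)` represented by the
product of the two meridians.  (Whether products of loops are read from left to right or from right to
left only matters up to inversion, since meridians are involutions in `O(K)`.) -/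
def omega {b : (Kᶜ : Set X)} {m₁ m₂ : LinkGroup K b} (h₁ : IsMeridian m₁) (h₂ : IsMeridian m₂) :
    H1DoubleCover K b :=
  Abelianization.of ⟨QuotientGroup.mk' (meridianSquares K b) (m₁ * m₂),
    mul_mem_doubleCoverGroup h₁ h₂⟩

theorem Tunnel.Represents.isMeridian {τ : Tunnel K} {b : (Kᶜ : Set X)} {m₁ m₂ : LinkGroup K b}
    (h : τ.Represents m₁ m₂) : IsMeridian m₁ ∧ IsMeridian m₂ := by
  obtain ⟨s, s', hs, e, e', he, he', β, rfl, rfl⟩ := h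
  exact ⟨⟨_, _, _, _, rfl⟩, ⟨_, _, _, _, rfl⟩⟩

/-! ## Strong inversions -/

variable (K) in
/-- A strong inversion of a link `K` in `S³`: an involution preserving `K` whose fixed point set is
a circle meeting every component of `K` in exactly two points.  (An involution of `S³` whose fixed
point set is a circle preserves the orientation, by Smith theory.) -/
structure IsStrongInversion (h : X ≃ₜ X) : Prop where
  involutive : Function.Involutive h
  preserves : h '' K = K
  circle : Nonempty (Function.fixedPoints h ≃ₜ Circle)
  two_points : ∀ x ∈ K, (Function.fixedPoints h ∩ connectedComponentIn K x).ncard = 2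

variable (K) in
/-- Two homeomorphisms of the pair `(X, K)` are pairwise isotopic. -/
def PairwiseIsotopic (f g : X ≃ₜ X) : Prop :=
  ∃ F : I → X ≃ₜ X, Continuous (fun z : I × X => F z.1 z.2) ∧ F 0 = f ∧ F 1 = g ∧
    ∀ t, F t '' K = K

end Pair

/-- An extra strong inversion of `K(r)`: one whose class in the symmetry group of `(S³, K(r))`
interchanges the upper and the lower tunnel, i.e. which is pairwise isotopic to a homeomorphism
interchanging them. -/
def TwoBridgeLink.IsExtraStrongInversion (L : TwoBridgeLink r) (h : S3 ≃ₜ S3) : Prop :=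
  IsStrongInversion L.link h ∧
    ∃ g : S3 ≃ₜ S3, PairwiseIsotopic L.link h g ∧
      g '' L.upperTunnel = L.lowerTunnel ∧ g '' L.lowerTunnel = L.upperTunnel

/-- An extra meridian pair: one determined by a tunnel contained in the fixed point set of an extra
strong inversion. -/
def TwoBridgeLink.IsExtraMeridianPair (L : TwoBridgeLink r) {b : ((L.link)ᶜ : Set S3)}
    (m₁ m₂ : LinkGroup L.link b) : Prop :=
  ∃ h : S3 ≃ₜ S3, L.IsExtraStrongInversion h ∧
    ∃ τ : Tunnel L.link, Set.range τ.arc ⊆ Function.fixedPoints h ∧ τ.Represents m₁ m₂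

theorem TwoBridgeLink.IsExtraMeridianPair.isMeridian {L : TwoBridgeLink r}
    {b : ((L.link)ᶜ : Set S3)} {m₁ m₂ : LinkGroup L.link b} (h : L.IsExtraMeridianPair m₁ m₂) :
    IsMeridian m₁ ∧ IsMeridian m₂ := by
  obtain ⟨_, _, τ, _, hτ⟩ := h
  exact hτ.isMeridian

end TwoBridge

end

/-!
The union of the two rational tangles is the quotient of a `3`-sphere in `ℂ²` by the dihedral group of
order `2p`, where `r = q / p`: with `ζ = exp (2πi / p)` the rotation acts by
`(z, w) ↦ (ζ z, ζ^{-q} w)` and the reflection is complex conjugation.  In the coordinates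
`(x, y, t) ∈ ℝ² × [0, 1]` the identification is induced by `toCover`, whose first coordinate winds with
`x` and whose second coordinate winds with `p y - q x`.  Only the fact that it is well defined and
that points off the strings go to points with trivial stabilizer (`toCover_mem_freeSet`) is needed:
it gives a regular covering of the link complement (pulled back from
`isQuotientCoveringMap_coverProj`) and a holonomy representation of the link group in the dihedral
group, under which meridians go to reflections (`parity_loop`).  The two meridians at the ends of the
upper tunnel have product a rotation by `± 1`, those at the ends of the lower tunnel a rotation by
`± v`, where `-q v = 1` modulo `p`: this is read off from neighbourhoods in `ℂ²` of the halves of the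
tunnels, each preserved by one reflection and disjoint from its other translates (`mul_eq_r_or`).

Now let `h` be a homeomorphism of the pair that fixes a tunnel `τ` pointwise, and consider the
covering pulled back by `h`.  Near an end point of `τ` the standard loop of a straightening chart and
its image under `h` both have the same holonomy as a small loop round the link, dragged along the fixed
arc `τ`, because this loop is an odd power of either and reflections have order two.  So the two
holonomies agree on the meridian pair of `τ` (`exists_holonomy_eq_of_represents`).  If the class of
`m₁ m₂` generates the homology of the double branched covering, then the restrictions of the two
representations to the kernel of the homomorphism to `ℤ/2`, which take values in the abelian group
of rotations, agree, hence so do the values on every product of two meridians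
(`eq_of_forall_mem_zpowers_omega`).

Take for these the meridian pair of the upper tunnel.  The original holonomy is a rotation by `± 1`.
The pulled-back one is, up to conjugation, unchanged along an isotopy from `h` to a homeomorphism that
carries the upper to the lower tunnel (`exists_pathLifts_of_isotopic`), and is therefore a rotation
by `± v`.  Hence `v = ± 1`, that is `q ≡ ± 1` modulo `p`, which is excluded for a hyperbolic slope.
-/

open scoped unitInterval Topology

noncomputable section

namespace TwoBridge

/-! ### Lifting paths through a quotient covering -/

section Covering

variable {E Q G : Type*} [TopologicalSpace E] [Group G] [MulAction G E] {π : E → Q}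

/-- The path `γ` in the base of `π` has a lift which runs from `e` to `e'`. -/
def PathLifts (π : E → Q) (γ : I → Q) (e e' : E) : Prop :=
  ∃ Γ : C(I, E), (∀ t, π (Γ t) = γ t) ∧ Γ 0 = e ∧ Γ 1 = e'

theorem PathLifts.apply_left {γ : I → Q} {e e' : E} (h : PathLifts π γ e e') : π e = γ 0 := by
  obtain ⟨Γ, h, rfl, rfl⟩ := h
  exact h 0

theorem PathLifts.apply_right {γ : I → Q} {e e' : E} (h : PathLifts π γ e e') : π e' = γ 1 := by
  obtain ⟨Γ, h, rfl, rfl⟩ := h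
  exact h 1

section Lifting

variable [TopologicalSpace Q]

theorem PathLifts.exists (hπ : IsCoveringMap π) {γ : I → Q} (hγ : Continuous γ) {e : E}
    (he : π e = γ 0) : ∃ e', PathLifts π γ e e' := by
  obtain ⟨Γ, h, h0⟩ := hπ.exists_path_lifts ⟨γ, hγ⟩ e he.symm
  exact ⟨Γ 1, Γ, fun t => congrFun h t, h0, rfl⟩

theorem PathLifts.unique (hπ : IsCoveringMap π) {γ : I → Q} {e e₁ e₂ : E}
    (h₁ : PathLifts π γ e e₁) (h₂ : PathLifts π γ e e₂) : e₁ = e₂ := by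
  obtain ⟨Γ, h, h0, rfl⟩ := h₁
  obtain ⟨Δ, k, k0, rfl⟩ := h₂
  have := hπ.eq_of_comp_eq Γ.continuous Δ.continuous
    (funext fun t => (h t).trans (k t).symm) 0 (h0.trans k0.symm)
  rw [DFunLike.coe_fn_eq.mp this]

theorem PathLifts.smul (hπ : IsQuotientCoveringMap π G) {γ : I → Q} {e e' : E}
    (h : PathLifts π γ e e') (g : G) : PathLifts π γ (g • e) (g • e') := by
  obtain ⟨Γ, h, rfl, rfl⟩ := h
  have := hπ.toContinuousConstSMul
  exact ⟨⟨fun t => g • Γ t, Γ.continuous.const_smul g⟩, fun t => (hπ.map_smul g).trans (h t),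
    rfl, rfl⟩

theorem PathLifts.exists_smul (hπ : IsQuotientCoveringMap π G) {γ : I → Q} (hγ : Continuous γ)
    (h01 : γ 0 = γ 1) {e : E} (he : π e = γ 0) : ∃ g : G, PathLifts π γ e (g • e) := by
  obtain ⟨e', h⟩ := PathLifts.exists hπ.isCoveringMap hγ he
  obtain ⟨g, hg⟩ := hπ.apply_eq_iff_mem_orbit.mp (h.apply_right.trans (h01.symm.trans he.symm))
  exact ⟨g, by rwa [show g • e = e' from hg]⟩

theorem PathLifts.smul_unique (hπ : IsQuotientCoveringMap π G) {γ : I → Q} {e : E} {g g' : G}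
    (h : PathLifts π γ e (g • e)) (h' : PathLifts π γ e (g' • e)) : g = g' :=
  hπ.isCancelSMul.right_cancel' _ _ _ (h.unique hπ.isCoveringMap h')

end Lifting

variable {Y : Type*} [TopologicalSpace Y] {f : Y → Q} {a b c : Y}

theorem PathLifts.trans {γ : Path a b} {δ : Path b c} {e e' e'' : E}
    (h : PathLifts π (fun t => f (γ t)) e e') (k : PathLifts π (fun t => f (δ t)) e' e'') :
    PathLifts π (fun t => f ((γ.trans δ) t)) e e'' := by
  obtain ⟨Γ, h, h0, h1⟩ := h
  obtain ⟨Δ, k, k0, k1⟩ := k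
  refine ⟨((⟨Γ, h0, h1⟩ : Path e e').trans ⟨Δ, k0, k1⟩).toContinuousMap, fun t => ?_, ?_, ?_⟩
  · change π (((⟨Γ, h0, h1⟩ : Path e e').trans ⟨Δ, k0, k1⟩) t) = f ((γ.trans δ) t)
    simp only [Path.trans_apply]
    split_ifs
    · exact h _
    · exact k _
  · exact Path.source _
  · exact Path.target _

theorem PathLifts.symm {γ : Path a b} {e e' : E} (h : PathLifts π (fun t => f (γ t)) e e') :
    PathLifts π (fun t => f (γ.symm t)) e' e := by
  obtain ⟨Γ, h, h0, h1⟩ := h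
  exact ⟨⟨fun t => Γ (σ t), by fun_prop⟩, fun t => h _, by simpa using h1, by simpa using h0⟩

variable [TopologicalSpace Q]

/-- Conjugating a loop by a path does not change its holonomy, if the base point of the cover is
carried along the path. -/
theorem PathLifts.conj (hπ : IsQuotientCoveringMap π G) {β : Path a b} {γ : Path b b} {e e' : E}
    {g : G} (h : PathLifts π (fun t => f (β t)) e e')
    (k : PathLifts π (fun t => f (γ t)) e' (g • e')) :
    PathLifts π (fun t => f (((β.trans γ).trans β.symm) t)) e (g • e) :=
  (h.trans k).trans (h.symm.smul hπ g)

/-- The holonomy homomorphism: the pull-back of a quotient covering along a continuous map `f`,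
together with a point of the covering over the base point, determines a homomorphism from
the fundamental group to the deck group.  As products of loops are read from right to left and deck
transformations act from the left, the holonomy of a loop whose lift runs from `e` to `g • e` is
`g⁻¹`. -/
def holonomy (hπ : IsQuotientCoveringMap π G) (f : C(Y, Q)) {b : Y} {e : E} (he : π e = f b) :
    FundamentalGroup Y b →* G :=
  (MulEquiv.inv' G).symm.toMonoidHom.comp
    ((hπ.fundamentalGroupToMulOpposite ⟨e, he⟩).comp (FundamentalGroup.map f b))

theorem holonomy_eq (hπ : IsQuotientCoveringMap π G) (f : C(Y, Q)) {b : Y} {e : E}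
    (he : π e = f b) {γ : Path b b} {g : G} (h : PathLifts π (fun t => f (γ t)) e (g • e)) :
    holonomy hπ f he (FundamentalGroup.fromPath ⟦γ⟧) = g⁻¹ := by
  obtain ⟨Γ, h, h0, h1⟩ := h
  have key : hπ.fundamentalGroupToMulOpposite ⟨e, he⟩
      (FundamentalGroup.map f b (FundamentalGroup.fromPath ⟦γ⟧)) = MulOpposite.op g := by
    rw [hπ.fundamentalGroupToMulOpposite_apply_eq_Iff]
    have hl := (hπ.isCoveringMap.eq_liftPath_iff' (γ := (γ.map f.continuous).toContinuousMap)
      (e := e) (by simpa using he.symm) (Γ := Γ)).mpr ⟨funext h, h0⟩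
    change g • e = hπ.isCoveringMap.liftPath (γ.map f.continuous).toContinuousMap e _ 1
    rw [← hl, h1]
  change (MulEquiv.inv' G).symm _ = _
  rw [show (hπ.fundamentalGroupToMulOpposite ⟨e, he⟩).comp (FundamentalGroup.map f b)
    (FundamentalGroup.fromPath ⟦γ⟧) = MulOpposite.op g from key]
  simp [MulEquiv.inv']

/-- The holonomy along freely homotopic loops: if the track of the base point lifts to a path from
`e` to `e'`, then the initial loop at `e` and the final loop at `e'` have the same holonomy. -/
theorem PathLifts.of_homotopy (hπ : IsQuotientCoveringMap π G) (H : C(I × I, Q))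
    (hH : ∀ s, H (s, 0) = H (s, 1)) {e e' : E} {g : G}
    (h : PathLifts π (fun s => H (s, 0)) e e')
    (k : PathLifts π (fun t => H (0, t)) e (g • e)) :
    PathLifts π (fun t => H (1, t)) e' (g • e') := by
  obtain ⟨Γ, k, k0, k1⟩ := k
  have H0 : ∀ t, H (0, t) = π (Γ t) := fun t => (k t).symm
  set F := hπ.isCoveringMap.liftHomotopy H Γ H0 with hF
  have hlift : ∀ z, π (F z) = H z := congrFun (hπ.isCoveringMap.liftHomotopy_lifts H Γ H0)
  have hzero : ∀ t, F (0, t) = Γ t := hπ.isCoveringMap.liftHomotopy_zero H Γ H0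
  have left : PathLifts π (fun s => H (s, 0)) e (F (1, 0)) :=
    ⟨⟨fun s => F (s, 0), by fun_prop⟩, fun s => hlift _, (hzero 0).trans k0, rfl⟩
  have right : PathLifts π (fun s => H (s, 0)) (g • e) (F (1, 1)) :=
    ⟨⟨fun s => F (s, 1), by fun_prop⟩, fun s => (hlift _).trans (hH s).symm,
      (hzero 1).trans k1, rfl⟩
  refine ⟨⟨fun t => F (1, t), by fun_prop⟩, fun t => hlift _, ?_, ?_⟩
  · exact left.unique hπ.isCoveringMap h
  · exact right.unique hπ.isCoveringMap (h.smul hπ g)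

/-- If an open set `V` of the covering space meets only its translates by `H`, then a loop in the
image of `V` has holonomy in `H`. -/
theorem PathLifts.mem_of_forall_mem_image (hπ : IsQuotientCoveringMap π G) {V : Set E}
    (hV : IsOpen V) {H : Set G} (hH : ∀ g : G, ∀ z ∈ V, g • z ∈ V ↔ g ∈ H) {γ : I → Q} {e : E}
    {g : G} (he : e ∈ V) (hγ : ∀ t, γ t ∈ π '' V) (h : PathLifts π γ e (g • e)) : g ∈ H := by
  obtain ⟨Γ, h, h0, h1⟩ := h
  have := hπ.toContinuousConstSMul
  have hopen : ∀ S : Set G, IsOpen {t : I | ∃ k ∈ S, k • Γ t ∈ V} := fun S => by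
    have : {t : I | ∃ k ∈ S, k • Γ t ∈ V} = ⋃ k ∈ S, (fun t => k • Γ t) ⁻¹' V := by
      ext t
      simp
    rw [this]
    exact isOpen_biUnion fun k _ => hV.preimage (Γ.continuous.const_smul k)
  have hA : IsClopen (Γ ⁻¹' V) := by
    refine ⟨⟨?_⟩, hV.preimage Γ.continuous⟩
    convert hopen Hᶜ using 1
    ext t
    obtain ⟨z, hz, hzt⟩ := hγ t
    obtain ⟨k, hk⟩ := hπ.apply_eq_iff_mem_orbit.mp (hzt.trans (h t).symm)
    replace hk : k • Γ t = z := hk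
    constructor
    · refine fun ht => ⟨k, fun hkH => ht ?_, hk ▸ hz⟩
      -- `H` is stable under inversion, because `V` is nonempty
      have hk' : k⁻¹ ∈ H := (hH _ _ ((hH k e he).mpr hkH)).mp (by rwa [inv_smul_smul])
      have := (hH _ _ hz).mpr hk'
      rwa [← hk, inv_smul_smul] at this
    · rintro ⟨k', hk', hk'V⟩ ht
      exact hk' ((hH k' _ ht).mp hk'V)
  have hne : (Γ ⁻¹' V).Nonempty := ⟨0, by rw [Set.mem_preimage, h0]; exact he⟩
  have key : ∀ t, Γ t ∈ V := fun t =>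
    ((isClopen_iff.mp hA).resolve_left hne.ne_empty).symm.subset (Set.mem_univ t)
  have := key 1
  rw [h1] at this
  exact (hH g e he).mp this

end Covering

/-! ### Loops in a straightening chart -/

namespace StraighteningChart

variable {X : Type} [TopologicalSpace X] {K : Set X}

theorem mem_target (e : StraighteningChart K) (y : ℂ × ℝ) : y ∈ e.chart.target :=
  e.target_eq ▸ Set.mem_univ y

theorem continuous_chart_symm (e : StraighteningChart K) : Continuous e.chart.symm := by
  have h := e.chart.continuousOn_symm
  rwa [e.target_eq, continuousOn_univ] at h

theorem symm_mem_iff (e : StraighteningChart K) (y : ℂ × ℝ) : e.chart.symm y ∈ K ↔ y.1 = 0 := by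
  rw [e.mem_iff _ (e.chart.map_target (e.mem_target y)), e.chart.right_inv (e.mem_target y)]

theorem chart_ne_zero (e : StraighteningChart K) {c : (Kᶜ : Set X)}
    (hc : (c : X) ∈ e.chart.source) : (e.chart c).1 ≠ 0 :=
  fun h => c.2 ((e.mem_iff _ hc).mpr h)

/-- The universal covering `(u, s) ↦ (exp u, s)` of the part off the axis, read in a chart. -/
def unroll (e : StraighteningChart K) : C(ℂ × ℝ, (Kᶜ : Set X)) where
  toFun y := ⟨e.chart.symm (Complex.exp y.1, y.2), fun h =>
    Complex.exp_ne_zero _ ((e.symm_mem_iff _).mp h)⟩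
  continuous_toFun := (e.continuous_chart_symm.comp (by fun_prop)).subtype_mk _

theorem unroll_mem_source (e : StraighteningChart K) (y : ℂ × ℝ) :
    (e.unroll y : X) ∈ e.chart.source :=
  e.chart.map_target (e.mem_target _)

theorem unroll_log (e : StraighteningChart K) {c : (Kᶜ : Set X)}
    (hc : (c : X) ∈ e.chart.source) :
    e.unroll (Complex.log (e.chart c).1, (e.chart c).2) = c := by
  apply Subtype.ext
  change e.chart.symm (Complex.exp (Complex.log (e.chart c).1), (e.chart c).2) = c
  rw [Complex.exp_log (e.chart_ne_zero hc)]
  exact e.chart.left_inv hc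

theorem unroll_eq_loop (e : StraighteningChart K) {c : (Kᶜ : Set X)}
    (hc : (c : X) ∈ e.chart.source) (t : I) :
    e.unroll (Complex.log (e.chart c).1 + 2 * Real.pi * Complex.I * (t : ℝ), (e.chart c).2) =
      e.loop c hc t := by
  apply Subtype.ext
  change e.chart.symm (Complex.exp (Complex.log (e.chart c).1 + _), (e.chart c).2) = _
  rw [Complex.exp_add, Complex.exp_log (e.chart_ne_zero hc), mul_comm]
  rfl

theorem loop_mem_source (e : StraighteningChart K) {c : (Kᶜ : Set X)}
    (hc : (c : X) ∈ e.chart.source) (t : I) : (e.loop c hc t : X) ∈ e.chart.source :=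
  e.chart.map_target (e.mem_target _)

theorem exists_path (e : StraighteningChart K) {c c' : (Kᶜ : Set X)}
    (hc : (c : X) ∈ e.chart.source) (hc' : (c' : X) ∈ e.chart.source) :
    ∃ γ : Path c c', ∀ t, (γ t : X) ∈ e.chart.source := by
  obtain ⟨γ⟩ := PathConnectedSpace.joined
    (Complex.log (e.chart c).1, (e.chart c).2) (Complex.log (e.chart c').1, (e.chart c').2)
  exact ⟨(γ.map e.unroll.continuous).cast (e.unroll_log hc).symm (e.unroll_log hc').symm,
    fun t => e.unroll_mem_source _⟩

variable {E Q G : Type*} [TopologicalSpace E] [TopologicalSpace Q] [Group G] [MulAction G E]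
  {π : E → Q}

/-- The fundamental group of `(ℂ ∖ {0}) × ℝ` is generated by the circle round the axis; hence the
holonomy of any loop in a chart is a power of that of the standard loop. -/
theorem exists_zpow_of_forall_mem_source (hπ : IsQuotientCoveringMap π G)
    (f : C((Kᶜ : Set X), Q)) (e : StraighteningChart K) {c : (Kᶜ : Set X)}
    (hc : (c : X) ∈ e.chart.source) {z : E} {g k : G}
    (hg : PathLifts π (fun t => f (e.loop c hc t)) z (g • z)) (γ : Path c c)
    (hγ : ∀ t, (γ t : X) ∈ e.chart.source)
    (hk : PathLifts π (fun t => f (γ t)) z (k • z)) : ∃ n : ℤ, k = g ^ n := by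
  have hcov := hπ.isCoveringMap
  have hsmul := hπ.toContinuousConstSMul
  set u := Complex.log (e.chart c).1 with hu
  set s := (e.chart c).2 with hs
  have hz : π z = f (e.unroll (u, s)) := by
    rw [e.unroll_log hc, hg.apply_left, (e.loop c hc).source]
  -- `F` is a lift to the covering of the universal covering of the punctured chart
  obtain ⟨F, ⟨hF0, hF⟩, -⟩ := hcov.existsUnique_continuousMap_lifts (f.comp e.unroll) (u, s) z hz
  have hF' : ∀ y, π (F y) = f (e.unroll y) := congrFun hF
  have hone : F (u + 2 * Real.pi * Complex.I, s) = g • z := by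
    refine PathLifts.unique hcov ⟨⟨fun t : I => F (u + 2 * Real.pi * Complex.I * (t : ℝ), s),
      by fun_prop⟩, fun t => ?_, ?_, ?_⟩ hg
    · exact (hF' _).trans (congrArg f (e.unroll_eq_loop hc t))
    · simp [hF0]
    · simp
  have hstep : ∀ y, F (y.1 + 2 * Real.pi * Complex.I, y.2) = g • F y := by
    refine congrFun (hcov.eq_of_comp_eq (by fun_prop) (F.continuous.const_smul g) (funext fun y => ?_)
      (u, s) (by rw [hF0]; exact hone))
    change π (F _) = π (g • F y)
    rw [hπ.map_smul, hF', hF']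
    congr 1
    apply Subtype.ext
    change e.chart.symm (Complex.exp (y.1 + _), y.2) = e.chart.symm (Complex.exp y.1, y.2)
    rw [Complex.exp_periodic]
  have hpow : ∀ n : ℤ, F (u + n * (2 * Real.pi * Complex.I), s) = g ^ n • z := by
    intro n
    induction n using Int.induction_on with
    | zero => simp [hF0]
    | succ n ih =>
      have := hstep (u + (n : ℤ) * (2 * Real.pi * Complex.I), s)
      rw [ih, ← mul_smul, ← zpow_one_add, add_comm 1] at this
      rw [← this]
      congr 2
      push_cast
      ring
    | pred n ih =>
      have := hstep (u + ((-n - 1 : ℤ) : ℂ) * (2 * Real.pi * Complex.I), s)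
      have he : u + ((-n - 1 : ℤ) : ℂ) * (2 * Real.pi * Complex.I) + 2 * Real.pi * Complex.I =
          u + ((-n : ℤ) : ℂ) * (2 * Real.pi * Complex.I) := by
        push_cast
        ring
      rw [he, ih, eq_comm, ← eq_inv_smul_iff, ← mul_smul] at this
      rw [this, sub_eq_neg_add, zpow_add, zpow_neg_one]
  obtain ⟨Γ, hΓ, hΓ0⟩ := Complex.isCoveringMap_exp.exists_path_lifts
    ⟨fun t : I => (⟨(e.chart (γ t)).1, e.chart_ne_zero (hγ t)⟩ : {z : ℂ // z ≠ 0}), by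
      refine Continuous.subtype_mk (continuous_fst.comp ?_) _
      exact e.chart.continuousOn.comp_continuous (by fun_prop) hγ⟩ u (by
      apply Subtype.ext
      simp only [ContinuousMap.coe_mk, γ.source]
      exact (Complex.exp_log (e.chart_ne_zero hc)).symm)
  have hΓ' : ∀ t, Complex.exp (Γ t) = (e.chart (γ t)).1 :=
    fun t => congrArg Subtype.val (congrFun hΓ t)
  have hunroll : ∀ t, e.unroll (Γ t, (e.chart (γ t)).2) = γ t := fun t => by
    apply Subtype.ext
    change e.chart.symm (Complex.exp (Γ t), (e.chart (γ t)).2) = γ t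
    rw [hΓ']
    exact e.chart.left_inv (hγ t)
  obtain ⟨n, hn⟩ : ∃ n : ℤ, Γ 1 = u + n * (2 * Real.pi * Complex.I) := by
    rw [← Complex.exp_eq_exp_iff_exists_int, hΓ', γ.target, Complex.exp_log (e.chart_ne_zero hc)]
  refine ⟨n, hk.smul_unique hπ ⟨⟨fun t => F (Γ t, (e.chart (γ t)).2), ?_⟩, fun t => ?_, ?_, ?_⟩⟩
  · refine F.continuous.comp (Γ.continuous.prodMk (continuous_snd.comp ?_))
    exact e.chart.continuousOn.comp_continuous (by fun_prop) hγ
  · exact (hF' _).trans (congrArg f (hunroll t))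
  · simp only [ContinuousMap.coe_mk, hΓ0, γ.source]
    exact hF0
  · simp only [ContinuousMap.coe_mk, hn, γ.target]
    exact hpow n

/-- The transport of a straightening chart along a homeomorphism of pairs. -/
def map {X' : Type} [TopologicalSpace X'] {K' : Set X'} (e : StraighteningChart K) (φ : X ≃ₜ X')
    (hφ : φ '' K = K') : StraighteningChart K' where
  chart := φ.symm.toOpenPartialHomeomorph.trans e.chart
  target_eq := by simp [e.target_eq]
  mem_iff x hx := by
    have hx' : φ.symm x ∈ e.chart.source := by simpa using hx
    rw [← hφ, φ.image_eq_preimage_symm, Set.mem_preimage, e.mem_iff _ hx']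
    rfl

theorem mem_map_source {X' : Type} [TopologicalSpace X'] {K' : Set X'} (e : StraighteningChart K)
    (φ : X ≃ₜ X') (hφ : φ '' K = K') {x : X'} :
    x ∈ (e.map φ hφ).chart.source ↔ φ.symm x ∈ e.chart.source := by
  simp [map]

theorem map_loop {X' : Type} [TopologicalSpace X'] {K' : Set X'} (e : StraighteningChart K)
    (φ : X ≃ₜ X') (hφ : φ '' K = K') {c : (Kᶜ : Set X)} {c' : (K'ᶜ : Set X')}
    (hc : (c : X) ∈ e.chart.source) (hc' : (c' : X') ∈ (e.map φ hφ).chart.source)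
    (h : φ c = c') (t : I) : ((e.map φ hφ).loop c' hc' t : X') = φ (e.loop c hc t) := by
  have : φ.symm c' = c := by rw [← h, φ.symm_apply_apply]
  change φ (e.chart.symm (_ * (e.chart (φ.symm c')).1, (e.chart (φ.symm c')).2)) = _
  rw [this]
  rfl

/-- Near a point of `K`, the standard loops are small. -/
theorem eventually_loop_mem (e : StraighteningChart K) {x : X} (hx : x ∈ e.chart.source)
    (hxK : x ∈ K) {N : Set X} (hN : N ∈ 𝓝 x) :
    ∀ᶠ c in 𝓝 x, ∀ h : c ∈ (Kᶜ : Set X), ∃ hc : c ∈ e.chart.source,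
      ∀ t, (e.loop ⟨c, h⟩ hc t : X) ∈ N := by
  have h0 : e.chart x = (0, (e.chart x).2) := Prod.ext ((e.mem_iff x hx).mp hxK) rfl
  have hN' : e.chart.symm ⁻¹' N ∈ 𝓝 (e.chart x) := by
    refine e.continuous_chart_symm.continuousAt.preimage_mem_nhds ?_
    rwa [e.chart.left_inv hx]
  obtain ⟨r, hr, hball⟩ := Metric.mem_nhds_iff.mp hN'
  have hball' : e.chart ⁻¹' Metric.ball (e.chart x) r ∈ 𝓝 x :=
    (e.chart.continuousAt hx).preimage_mem_nhds (Metric.ball_mem_nhds _ hr)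
  filter_upwards [hball', e.chart.open_source.mem_nhds hx] with c hcr hcs h
  refine ⟨hcs, fun t => hball (a := (_, _)) ?_⟩
  rw [Set.mem_preimage, Metric.mem_ball, h0, Prod.dist_eq, max_lt_iff, dist_zero_right] at hcr
  rw [Metric.mem_ball, h0, Prod.dist_eq, max_lt_iff, dist_zero_right]
  refine ⟨?_, hcr.2⟩
  rw [norm_mul]
  have : ‖Complex.exp (2 * Real.pi * Complex.I * ((t : ℝ) : ℂ))‖ = 1 := by
    rw [Complex.norm_exp]
    simp
  rw [this, one_mul]
  exact hcr.1

end StraighteningChart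

/-! ### The dihedral group and its actions on the plane -/

section Dihedral

variable {n : ℕ}

/-- The homomorphism from the dihedral group to `ℤ/2` which is trivial precisely on the
rotations. -/
def parity : DihedralGroup n →* Multiplicative (ZMod 2) where
  toFun
    | .r _ => 1
    | .sr _ => Multiplicative.ofAdd 1
  map_one' := rfl
  map_mul' := by
    rintro (i | i) (j | j) <;> (simp; try rfl)

@[simp] theorem parity_r (i : ZMod n) : parity (.r i) = 1 := rfl

@[simp] theorem parity_sr (i : ZMod n) : parity (.sr i) = Multiplicative.ofAdd 1 := rfl

theorem eq_sr_of_parity {g : DihedralGroup n} (h : parity g = Multiplicative.ofAdd 1) :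
    ∃ i, g = .sr i := by
  rcases g with i | i
  · exact absurd (show (1 : Multiplicative (ZMod 2)) = Multiplicative.ofAdd 1 from h) (by decide)
  · exact ⟨i, rfl⟩

theorem mul_self_of_parity {g : DihedralGroup n} (h : parity g = Multiplicative.ofAdd 1) :
    g * g = 1 := by
  obtain ⟨i, rfl⟩ := eq_sr_of_parity h
  simp

/-- A reflection which is a power of `g` forces `g` to be this reflection, if `g` is one. -/
theorem eq_of_zpow_of_parity {g k : DihedralGroup n} (hg : parity g = Multiplicative.ofAdd 1)
    (hk : parity k = Multiplicative.ofAdd 1) {m : ℤ} (h : k = g ^ m) : k = g := by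
  have hgg : g ^ (2 : ℤ) = 1 := by
    rw [zpow_two]
    exact mul_self_of_parity hg
  obtain ⟨l, rfl | rfl⟩ := Int.even_or_odd' m
  · rw [zpow_mul, hgg, one_zpow] at h
    rw [h, map_one] at hk
    exact absurd hk (by decide)
  · rw [h, zpow_add, zpow_mul, hgg, one_zpow, one_mul, zpow_one]

theorem parity_of_zpow {g k : DihedralGroup n}
    (hk : parity k = Multiplicative.ofAdd 1) {m : ℤ} (h : k = g ^ m) :
    parity g = Multiplicative.ofAdd 1 := by
  rcases g with i | i
  · rw [h, map_zpow, parity_r, one_zpow] at hk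
    exact absurd hk (by decide)
  · rfl

theorem conj_r (g : DihedralGroup n) (i : ZMod n) :
    g * .r i * g⁻¹ = .r i ∨ g * .r i * g⁻¹ = .r (-i) := by
  rcases g with j | j
  · left
    simp
  · right
    simp

variable [NeZero n]

/-- The action of the dihedral group on the plane in which the generating rotation turns by `u/n` of
a full turn. -/
def planeAct (u : ZMod n) : DihedralGroup n → ℂ → ℂ
  | .r i, w => ZMod.stdAddChar (u * i) * w
  | .sr i, w => (starRingEnd ℂ) (ZMod.stdAddChar (u * i) * w)

theorem conj_stdAddChar (i : ZMod n) :
    (starRingEnd ℂ) (ZMod.stdAddChar i) = ZMod.stdAddChar (-i) := by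
  rw [ZMod.stdAddChar_apply, ZMod.stdAddChar_apply, AddChar.map_neg_eq_inv, Circle.coe_inv_eq_conj]

theorem planeAct_one (u : ZMod n) (w : ℂ) : planeAct u 1 w = w := by
  rw [DihedralGroup.one_def]
  simp [planeAct]

theorem planeAct_mul (u : ZMod n) (g h : DihedralGroup n) (w : ℂ) :
    planeAct u (g * h) w = planeAct u g (planeAct u h w) := by
  rcases g with i | i <;> rcases h with j | j <;>
    simp only [planeAct, DihedralGroup.r_mul_r, DihedralGroup.r_mul_sr, DihedralGroup.sr_mul_r,
      DihedralGroup.sr_mul_sr, map_mul, conj_stdAddChar, Complex.conj_conj, ← mul_assoc,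
      ← AddChar.map_add_eq_mul] <;> congr 2 <;> ring

theorem continuous_planeAct (u : ZMod n) (g : DihedralGroup n) : Continuous (planeAct u g) := by
  rcases g with i | i
  · exact continuous_const.mul continuous_id
  · exact Complex.continuous_conj.comp (continuous_const.mul continuous_id)

/-- The open sector of angle `2π/n` about the positive real axis (without its apex). -/
def sector (n : ℕ) : Set ℂ := {w | w ∈ Complex.slitPlane ∧ |w.arg| < Real.pi / n}

omit [NeZero n] in
theorem isOpen_sector : IsOpen (sector n) := by
  have h : ContinuousOn (fun w : ℂ => |w.arg|) Complex.slitPlane := fun w hw =>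
    (Complex.continuousAt_arg hw).abs.continuousWithinAt
  exact h.isOpen_inter_preimage Complex.isOpen_slitPlane isOpen_Iio

omit [NeZero n] in
theorem conj_mem_sector {w : ℂ} : (starRingEnd ℂ) w ∈ sector n ↔ w ∈ sector n := by
  have : ∀ w : ℂ, w ∈ sector n → (starRingEnd ℂ) w ∈ sector n := by
    rintro w ⟨h, k⟩
    have h' := Complex.mem_slitPlane_iff_arg.mp h
    refine ⟨?_, ?_⟩
    · rw [Complex.mem_slitPlane_iff] at h ⊢
      simpa using h
    · rwa [Complex.arg_conj, if_neg h'.1, abs_neg]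
  exact ⟨fun h => by simpa using this _ h, this w⟩

/-- A sector is disjoint from its rotated copies. -/
theorem stdAddChar_mul_mem_sector {w : ℂ} (hw : w ∈ sector n) {i : ZMod n} :
    ZMod.stdAddChar i * w ∈ sector n ↔ i = 0 := by
  refine ⟨fun h => ?_, fun h => by simpa [h] using hw⟩
  obtain ⟨k, rfl⟩ := ZMod.intCast_surjective i
  have hn : (0 : ℝ) < n := by exact_mod_cast NeZero.pos n
  have hw0 : w ≠ 0 := Complex.slitPlane_ne_zero hw.1
  have hang : (((ZMod.stdAddChar (k : ZMod n) * w).arg : ℝ) : Real.Angle) =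
      ((2 * Real.pi * k / n + w.arg : ℝ) : Real.Angle) := by
    rw [Complex.arg_mul_coe_angle (by simp [ZMod.stdAddChar_apply]) hw0, ZMod.stdAddChar_coe,
      Real.Angle.coe_add]
    congr 1
    rw [show (2 * Real.pi * Complex.I * k / n : ℂ) = ((2 * Real.pi * k / n : ℝ) : ℂ) * Complex.I by
      push_cast; ring, Complex.arg_exp_mul_I, Real.Angle.coe_toIocMod]
  obtain ⟨m, hm⟩ := Real.Angle.angle_eq_iff_two_pi_dvd_sub.mp hang
  have h1 := abs_lt.mp h.2
  have h2 := abs_lt.mp hw.2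
  have hpi := Real.pi_pos
  have hkey : |((k + n * m : ℤ) : ℝ)| < 1 := by
    have e : ((k + n * m : ℤ) : ℝ) * (2 * (Real.pi / n)) =
        (ZMod.stdAddChar (k : ZMod n) * w).arg - w.arg := by
      have hm' : (ZMod.stdAddChar (k : ZMod n) * w).arg =
        2 * Real.pi * k / n + w.arg + 2 * Real.pi * m := by linarith
      rw [hm']
      push_cast
      field_simp
      ring
    have hpn : 0 < Real.pi / n := by positivity
    rw [abs_lt]
    constructor <;> nlinarith
  have hz : k + n * m = 0 := by
    have : |k + n * m| < 1 := by exact_mod_cast hkey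
    exact Int.abs_lt_one_iff.mp this
  have : ((k + n * m : ℤ) : ZMod n) = 0 := by rw [hz]; simp
  simpa using this

omit [NeZero n] in
/-- A point on the ray of angle `θ` lies in the sector if `|θ| < π/n`. -/
theorem mul_exp_mem_sector (hn : 2 ≤ n) {s θ : ℝ} (hs : 0 < s) (hθ : |θ| < 1) :
    (s : ℂ) * Complex.exp (Real.pi * Complex.I * θ / n) ∈ sector n := by
  have hn' : (2 : ℝ) ≤ n := by exact_mod_cast hn
  have hn0 : (0 : ℝ) < n := by linarith
  have e : Complex.exp (Real.pi * Complex.I * θ / n) =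
      Complex.exp (((Real.pi * θ / n : ℝ) : ℂ) * Complex.I) := by
    congr 1
    push_cast
    ring
  have hb : |Real.pi * θ / n| < Real.pi / n := by
    rw [abs_div, abs_mul, abs_of_pos Real.pi_pos, abs_of_pos hn0]
    gcongr
    nlinarith [Real.pi_pos]
  have hpn : Real.pi / n < Real.pi := by
    rw [div_lt_iff₀ hn0]
    nlinarith [Real.pi_pos]
  have hb' := abs_lt.mp (hb.trans hpn)
  have harg : ((s : ℂ) * Complex.exp (Real.pi * Complex.I * θ / n)).arg = Real.pi * θ / n := by
    rw [Complex.arg_real_mul _ hs, e, Complex.arg_exp_mul_I, toIocMod_eq_self]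
    constructor <;> linarith
  refine ⟨Complex.mem_slitPlane_iff_arg.mpr ⟨?_, ?_⟩, ?_⟩
  · rw [harg]
    exact hb'.2.ne
  · exact mul_ne_zero (by exact_mod_cast hs.ne') (Complex.exp_ne_zero _)
  · rwa [harg]

/-- The sector rotated to the ray of angle `π j/n` is a fundamental domain up to one reflection:
the reflection in this ray. -/
theorem planeAct_mem_sector {u v : ZMod n} (huv : u * v = 1) (j : ℤ) (g : DihedralGroup n) {w : ℂ}
    (hw : w * Complex.exp (-(Real.pi * Complex.I * j / n)) ∈ sector n) :
    planeAct u g w * Complex.exp (-(Real.pi * Complex.I * j / n)) ∈ sector n ↔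
      g ∈ ({1, .sr (-(v * j))} : Set (DihedralGroup n)) := by
  have hcancel : ∀ i : ZMod n, u * i = 0 ↔ i = 0 := fun i =>
    ⟨fun h => by rw [← one_mul i, ← huv, mul_right_comm, mul_comm, h, mul_zero] , fun h => by simp [h]⟩
  rcases g with i | i
  · rw [planeAct, mul_assoc, stdAddChar_mul_mem_sector hw, hcancel]
    rw [Set.mem_insert_iff, DihedralGroup.one_def]
    simp [-DihedralGroup.r_zero]
  · have hrot : planeAct u (.sr i) w * Complex.exp (-(Real.pi * Complex.I * j / n)) =
        (starRingEnd ℂ) (ZMod.stdAddChar (u * i + (j : ZMod n)) *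
          (w * Complex.exp (-(Real.pi * Complex.I * j / n)))) := by
      simp only [planeAct, map_mul, ← Complex.exp_conj, AddChar.map_add_eq_mul,
        ZMod.stdAddChar_coe, map_neg, map_div₀, Complex.conj_ofReal, Complex.conj_I, map_intCast,
        map_natCast, map_ofNat]
      rw [show -(Real.pi * Complex.I * j / n : ℂ) = 2 * Real.pi * (-Complex.I) * j / n +
        -(Real.pi * (-Complex.I) * j / n) by ring, Complex.exp_add]
      ring
    rw [hrot, conj_mem_sector, stdAddChar_mul_mem_sector hw]
    have : u * i + (j : ZMod n) = u * (i + v * j) := by rw [mul_add, ← mul_assoc, huv, one_mul]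
    rw [this, hcancel, add_eq_zero_iff_eq_neg]
    rw [Set.mem_insert_iff, DihedralGroup.one_def]
    simp [-DihedralGroup.r_zero]

end Dihedral

/-! ### The dihedral covering of the link complement -/

section Model

instance (r : ℚ) : NeZero r.den := ⟨r.den_nz⟩

/-- The plane `ℂ²`, with the action of the dihedral group of order `2p` in which the generating
rotation is `(z, w) ↦ (ζ z, ζ^{-q} w)`, `ζ = exp (2πi/p)`, and the reflection is complex
conjugation. -/
def CoverPlane (_ : ℚ) : Type := ℂ × ℂ

variable (r : ℚ)

instance : TopologicalSpace (CoverPlane r) := inferInstanceAs (TopologicalSpace (ℂ × ℂ))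
instance : T2Space (CoverPlane r) := inferInstanceAs (T2Space (ℂ × ℂ))
instance : LocallyCompactSpace (CoverPlane r) := inferInstanceAs (LocallyCompactSpace (ℂ × ℂ))

instance : MulAction (DihedralGroup r.den) (CoverPlane r) where
  smul g z := (planeAct 1 g z.1, planeAct (-(r.num : ZMod r.den)) g z.2)
  one_smul _ := Prod.ext (planeAct_one _ _) (planeAct_one _ _)
  mul_smul _ _ _ := Prod.ext (planeAct_mul _ _ _ _) (planeAct_mul _ _ _ _)

variable {r}

theorem smul_fst (g : DihedralGroup r.den) (z : CoverPlane r) : (g • z).1 = planeAct 1 g z.1 := rfl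

theorem smul_snd (g : DihedralGroup r.den) (z : CoverPlane r) :
    (g • z).2 = planeAct (-(r.num : ZMod r.den)) g z.2 := rfl

instance : ContinuousConstSMul (DihedralGroup r.den) (CoverPlane r) where
  continuous_const_smul g :=
    ((continuous_planeAct _ g).comp continuous_fst).prodMk
      ((continuous_planeAct _ g).comp continuous_snd)

variable (r)

/-- The quotient of `ℂ²` by the dihedral group. -/
abbrev CoverQuotient : Type := Quotient (MulAction.orbitRel (DihedralGroup r.den) (CoverPlane r))

/-- The set of points of `ℂ²` with trivial stabilizer. -/
def freeSet : Set (CoverPlane r) := {z | ∀ g : DihedralGroup r.den, g • z = z → g = 1}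

/-- The image of the points with trivial stabilizer in the quotient of `ℂ²`. -/
def regularSet : Set (CoverQuotient r) :=
  Quotient.mk (MulAction.orbitRel (DihedralGroup r.den) (CoverPlane r)) '' freeSet r

/-- The part of `ℂ²` on which the dihedral group acts freely. -/
abbrev FreeCover : Type :=
  (Quotient.mk (MulAction.orbitRel (DihedralGroup r.den) (CoverPlane r))) ⁻¹' regularSet r

variable {r}

theorem smul_mem_freeSet {z : CoverPlane r} (hz : z ∈ freeSet r) (g : DihedralGroup r.den) :
    g • z ∈ freeSet r := by
  intro k hk
  have h : (g⁻¹ * k * g) • z = z := by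
    rw [mul_smul, mul_smul, hk, inv_smul_smul]
  have := hz _ h
  rw [mul_assoc, inv_mul_eq_one] at this
  exact mul_eq_right.mp this.symm

theorem mem_regularSet_iff {z : CoverPlane r} :
    Quotient.mk (MulAction.orbitRel (DihedralGroup r.den) (CoverPlane r)) z ∈ regularSet r ↔
      z ∈ freeSet r := by
  refine ⟨?_, fun h => ⟨z, h, rfl⟩⟩
  rintro ⟨y, hy, hyz⟩
  obtain ⟨g, rfl⟩ := Quotient.exact hyz
  have := smul_mem_freeSet hy g⁻¹
  rwa [inv_smul_smul] at this

theorem isOpen_freeSet : IsOpen (freeSet r) := by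
  have : freeSet r = ⋂ g ∈ ({1}ᶜ : Set (DihedralGroup r.den)), {z | g • z = z}ᶜ := by
    ext z
    simp only [freeSet, Set.mem_ofPred_eq, Set.mem_iInter, Set.mem_compl_iff, Set.mem_singleton_iff]
    exact forall_congr' fun g => ⟨fun h k l => k (h l), fun h k => by_contra fun l => h l k⟩
  rw [this]
  exact (Set.toFinite _).isOpen_biInter fun g _ =>
    (isClosed_eq (continuous_const_smul g) continuous_id).isOpen_compl

instance : MulAction (DihedralGroup r.den) (FreeCover r) where
  smul g z := ⟨g • z.1, mem_regularSet_iff.mpr (smul_mem_freeSet (mem_regularSet_iff.mp z.2) g)⟩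
  one_smul _ := Subtype.ext (one_smul _ _)
  mul_smul _ _ _ := Subtype.ext (mul_smul _ _ _)

instance : ContinuousConstSMul (DihedralGroup r.den) (FreeCover r) where
  continuous_const_smul g := ((continuous_const_smul g).comp continuous_subtype_val).subtype_mk _

instance : IsCancelSMul (DihedralGroup r.den) (FreeCover r) where
  right_cancel' g h z hz := by
    rw [← inv_smul_eq_iff, ← mul_smul] at hz
    have := mem_regularSet_iff.mp z.2 _ (congrArg Subtype.val hz)
    exact (inv_mul_eq_one.mp this).symm

variable (r) in
/-- The dihedral covering. -/
def coverProj : FreeCover r → regularSet r :=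
  (regularSet r).restrictPreimage
    (Quotient.mk (MulAction.orbitRel (DihedralGroup r.den) (CoverPlane r)))

theorem isQuotientCoveringMap_coverProj :
    IsQuotientCoveringMap (coverProj r) (DihedralGroup r.den) := by
  have hq : IsOpenQuotientMap (Quotient.mk (MulAction.orbitRel (DihedralGroup r.den)
    (CoverPlane r))) := MulAction.isOpenQuotientMap_quotientMk
  have hloc : LocallyCompactSpace (FreeCover r) := by
    have : IsOpen (Quotient.mk (MulAction.orbitRel (DihedralGroup r.den) (CoverPlane r)) ⁻¹'
        regularSet r) := by
      convert isOpen_freeSet (r := r)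
      ext z
      exact mem_regularSet_iff
    exact this.locallyCompactSpace
  have hq' := (hq.restrictPreimage (regularSet r)).isQuotientMap
  refine hq'.isQuotientCoveringMap_of_properlyDiscontinuousSMul fun {z w} => ?_
  rw [Subtype.ext_iff]
  change Quotient.mk _ z.1 = Quotient.mk _ w.1 ↔ _
  rw [Quotient.eq]
  constructor
  · rintro ⟨g, hg⟩
    exact ⟨g, Subtype.ext hg⟩
  · rintro ⟨g, hg⟩
    exact ⟨g, congrArg Subtype.val hg⟩

variable (r)

/-- The map `ℝ² × [0, 1] → ℂ²` whose first coordinate winds along the lines transverse to slope `∞`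
and collapses at height `1`, and whose second coordinate winds along the lines transverse to
slope `r` and collapses at height `0`.  It carries the group `𝒥` to the dihedral group and induces a
homeomorphism of the union of the two tangles onto the quotient of the `3`-sphere `|z| + |w| = 1`. -/
def toCover (x : (ℝ × ℝ) × I) : CoverPlane r :=
  (((1 - x.2 : ℝ) : ℂ) * Complex.exp (Real.pi * Complex.I * (x.1.1 : ℝ) / r.den),
    ((x.2 : ℝ) : ℂ) * Complex.exp (Real.pi * Complex.I *
      ((r.den * x.1.2 - r.num * x.1.1 : ℝ) : ℂ) / r.den))

theorem continuous_toCover : Continuous (toCover r) := by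
  refine Continuous.prodMk ?_ ?_ <;> fun_prop

variable {r}

theorem exp_add_two_mul (θ : ℝ) (k : ℤ) {n : ℕ} [NeZero n] :
    Complex.exp (Real.pi * Complex.I * ((θ + 2 * k : ℝ) : ℂ) / n) =
      ZMod.stdAddChar (k : ZMod n) * Complex.exp (Real.pi * Complex.I * θ / n) := by
  rw [ZMod.stdAddChar_coe, ← Complex.exp_add]
  congr 1
  push_cast
  ring

theorem exp_two_mul_sub (θ : ℝ) (k : ℤ) {n : ℕ} [NeZero n] :
    Complex.exp (Real.pi * Complex.I * ((2 * k - θ : ℝ) : ℂ) / n) =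
      (starRingEnd ℂ) (ZMod.stdAddChar (-(k : ZMod n)) *
        Complex.exp (Real.pi * Complex.I * θ / n)) := by
  rw [map_mul, conj_stdAddChar, neg_neg, ZMod.stdAddChar_coe, ← Complex.exp_conj,
    ← Complex.exp_add]
  congr 1
  simp only [map_div₀, map_mul, Complex.conj_ofReal, Complex.conj_I, map_natCast]
  push_cast
  ring

/-- The translation by `2 (a, b)` acts on the cover as a rotation. -/
theorem toCover_add (v : ℝ × ℝ) (t : I) (a b : ℤ) :
    toCover r ((v.1 + 2 * a, v.2 + 2 * b), t) =
      (DihedralGroup.r (a : ZMod r.den)) • toCover r (v, t) := by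
  apply Prod.ext
  · rw [smul_fst]
    simp only [toCover, planeAct, one_mul]
    rw [exp_add_two_mul]
    ring
  · rw [smul_snd]
    simp only [toCover, planeAct]
    have : (r.den * (v.2 + 2 * b) - r.num * (v.1 + 2 * a) : ℝ) =
      (r.den * v.2 - r.num * v.1) + 2 * ((r.den * b - r.num * a : ℤ) : ℝ) := by push_cast; ring
    rw [this, exp_add_two_mul]
    push_cast
    rw [ZMod.natCast_self]
    ring_nf

/-- The rotation about `(a, b)` acts on the cover as a reflection. -/
theorem toCover_sub (v : ℝ × ℝ) (t : I) (a b : ℤ) :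
    toCover r ((2 * a - v.1, 2 * b - v.2), t) =
      (DihedralGroup.sr (-(a : ZMod r.den))) • toCover r (v, t) := by
  apply Prod.ext
  · rw [smul_fst]
    simp only [toCover, planeAct, one_mul]
    rw [exp_two_mul_sub]
    simp only [map_mul, Complex.conj_ofReal]
    ring
  · rw [smul_snd]
    simp only [toCover, planeAct]
    have : (r.den * (2 * b - v.2) - r.num * (2 * a - v.1) : ℝ) =
      2 * ((r.den * b - r.num * a : ℤ) : ℝ) - (r.den * v.2 - r.num * v.1) := by push_cast; ring
    rw [this, exp_two_mul_sub]
    simp only [map_mul, Complex.conj_ofReal]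
    push_cast
    rw [ZMod.natCast_self]
    ring_nf

theorem toCover_one {v w : ℝ × ℝ}
    (h : r.den * v.2 - r.num * v.1 = r.den * w.2 - r.num * w.1) :
    toCover r (v, 1) = toCover r (w, 1) := by
  simp [toCover, h]
  rfl

theorem toCover_pillow {v w : ℝ × ℝ} (h : PillowRel v w) (t : I) :
    ∃ g : DihedralGroup r.den, g • toCover r (v, t) = toCover r (w, t) := by
  obtain ⟨a, b, rfl | rfl⟩ := h
  · exact ⟨_, (toCover_add v t a b).symm⟩
  · exact ⟨_, (toCover_sub v t a b).symm⟩

theorem toCover_glue {x y : (ℝ × ℝ) × I} (h : GlueRel r x y) :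
    ∃ g : DihedralGroup r.den, g • toCover r x = toCover r y := by
  obtain ⟨v, t⟩ := x
  obtain ⟨w, t'⟩ := y
  obtain ⟨ht, h | ⟨h0, c, h⟩ | ⟨h1, c, h⟩⟩ := h
  · obtain rfl : t = t' := ht
    exact toCover_pillow h t
  · obtain rfl : t = t' := ht
    obtain rfl : t = 0 := h0
    obtain ⟨g, hg⟩ := toCover_pillow (r := r) h 0
    refine ⟨g, ?_⟩
    rw [← hg]
    congr 1
    simp [toCover, dirInfty]
    rfl
  · obtain rfl : t = t' := ht
    obtain rfl : t = 1 := h1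
    obtain ⟨g, hg⟩ := toCover_pillow (r := r) h 1
    refine ⟨g, ?_⟩
    rw [← hg]
    congr 1
    refine toCover_one ?_
    simp only [dirSlope]
    ring

variable (r) in
/-- The map of the union of the two tangles to the dihedral quotient induced by `toCover`. -/
def tangleToQuotient : TangleUnion r → CoverQuotient r :=
  Quotient.lift (fun x => Quotient.mk _ (toCover r x)) fun _ _ h => by
    obtain ⟨g, hg⟩ := toCover_glue h
    exact Quotient.sound (MulAction.orbitRel_apply.mpr ⟨g⁻¹, by simp [← hg]⟩)

theorem tangleToQuotient_mk (x : (ℝ × ℝ) × I) :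
    tangleToQuotient r (TangleUnion.mk r x) = Quotient.mk _ (toCover r x) := rfl

theorem continuous_tangleToQuotient : Continuous (tangleToQuotient r) :=
  Continuous.quotient_lift (continuous_quotient_mk'.comp (continuous_toCover r)) _

theorem continuous_mk : Continuous (TangleUnion.mk r) := continuous_quotient_mk'

theorem mk_eq_iff {x y : (ℝ × ℝ) × I} :
    TangleUnion.mk r x = TangleUnion.mk r y ↔ GlueRel r x y :=
  Quotient.eq (r := glueSetoid r)

theorem mk_surjective : Function.Surjective (TangleUnion.mk r) := Quotient.mk_surjective

theorem mk_mem_stringsUnion_of_int (a b : ℤ) (t : I) :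
    TangleUnion.mk r (((a : ℝ), (b : ℝ)), t) ∈ stringsUnion r := ⟨a, b, t, rfl⟩

theorem PillowRel.exists_int {v : ℝ × ℝ} {a b : ℤ} (h : PillowRel v (a, b)) :
    ∃ a' b' : ℤ, v = ((a' : ℝ), (b' : ℝ)) := by
  obtain ⟨c, d, h | h⟩ := h.symm
  · exact ⟨a + 2 * c, b + 2 * d, by rw [h]; push_cast; rfl⟩
  · exact ⟨2 * c - a, 2 * d - b, by rw [h]; push_cast; rfl⟩

/-- Away from the two cores, the strings are the lines over the lattice points. -/
theorem mk_mem_stringsUnion_iff {v : ℝ × ℝ} {t : I} (h0 : t ≠ 0) (h1 : t ≠ 1) :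
    TangleUnion.mk r (v, t) ∈ stringsUnion r ↔ ∃ a b : ℤ, v = ((a : ℝ), (b : ℝ)) := by
  constructor
  · rintro ⟨a, b, t', h⟩
    obtain ⟨ht, h | ⟨h, -⟩ | ⟨h, -⟩⟩ := mk_eq_iff.mp h
    · exact h.exists_int
    · exact absurd h h0
    · exact absurd h h1
  · rintro ⟨a, b, rfl⟩
    exact mk_mem_stringsUnion_of_int a b t

/-- The strings meet the core of slope `∞` in the leaves through lattice points. -/
theorem mk_zero_mem_stringsUnion_iff {v : ℝ × ℝ} :
    TangleUnion.mk r (v, 0) ∈ stringsUnion r ↔ ∃ a : ℤ, v.1 = a := by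
  constructor
  · rintro ⟨a, b, t', h⟩
    obtain ⟨ht, h | ⟨-, c, h⟩ | ⟨h, -⟩⟩ := mk_eq_iff.mp h
    · obtain ⟨a', b', rfl⟩ := h.exists_int
      exact ⟨a', rfl⟩
    · obtain ⟨a', b', h⟩ := h.exists_int
      refine ⟨a', ?_⟩
      simpa [dirInfty] using congrArg Prod.fst h
    · exact absurd h zero_ne_one
  · rintro ⟨a, ha⟩
    refine ⟨a, 0, 0, mk_eq_iff.mpr ⟨rfl, Or.inr (Or.inl ⟨rfl, -v.2, ?_⟩)⟩⟩
    have : (v.1 + -v.2 * dirInfty.1, v.2 + -v.2 * dirInfty.2) = ((a : ℝ), ((0 : ℤ) : ℝ)) := by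
      simp [dirInfty, ha]
    rw [this]
    exact PillowRel.refl _

/-- The strings meet the core of slope `r` in the leaves through lattice points. -/
theorem mk_one_mem_stringsUnion_iff {v : ℝ × ℝ} :
    TangleUnion.mk r (v, 1) ∈ stringsUnion r ↔ ∃ m : ℤ, r.den * v.2 - r.num * v.1 = m := by
  constructor
  · rintro ⟨a, b, t', h⟩
    obtain ⟨ht, h | ⟨h, -⟩ | ⟨-, c, h⟩⟩ := mk_eq_iff.mp h
    · obtain ⟨a', b', rfl⟩ := h.exists_int
      exact ⟨r.den * b' - r.num * a', by push_cast; rfl⟩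
    · exact absurd h one_ne_zero
    · obtain ⟨a', b', h⟩ := h.exists_int
      refine ⟨r.den * b' - r.num * a', ?_⟩
      have h1 := congrArg Prod.fst h
      have h2 := congrArg Prod.snd h
      simp only [dirSlope] at h1 h2
      push_cast
      rw [← h1, ← h2]
      ring
  · rintro ⟨m, hm⟩
    have hcop : IsCoprime (r.den : ℤ) r.num := by
      rw [Int.isCoprime_iff_gcd_eq_one, Int.gcd_comm]
      exact r.reduced
    obtain ⟨x, y, hxy⟩ := hcop
    have hp : (r.den : ℝ) ≠ 0 := by exact_mod_cast r.den_nz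
    have hxy' : (x * r.den + y * r.num : ℝ) = 1 := by exact_mod_cast hxy
    -- the lattice point `(-m y, m x)` lies on the leaf
    refine ⟨-m * y, m * x, 1, mk_eq_iff.mpr ⟨rfl, Or.inr (Or.inr ⟨rfl,
      (-m * y - v.1) / r.den, ?_⟩)⟩⟩
    have : (v.1 + (-m * y - v.1) / r.den * (dirSlope r).1,
        v.2 + (-m * y - v.1) / r.den * (dirSlope r).2) =
          (((-m * y : ℤ) : ℝ), ((m * x : ℤ) : ℝ)) := by
      simp only [dirSlope]
      apply Prod.ext
      · field_simp
        push_cast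
        ring
      · field_simp
        push_cast
        linear_combination hm - m * hxy'
    rw [this]
    exact PillowRel.refl _

theorem exists_int_of_exp_eq {α β : ℝ} {n : ℕ} [NeZero n]
    (h : Complex.exp (Real.pi * Complex.I * α / n) = Complex.exp (Real.pi * Complex.I * β / n)) :
    ∃ m : ℤ, α = β + 2 * n * m := by
  obtain ⟨m, hm⟩ := Complex.exp_eq_exp_iff_exists_int.mp h
  refine ⟨m, ?_⟩
  have hn : (n : ℂ) ≠ 0 := by exact_mod_cast NeZero.ne n
  have hpi : (Real.pi : ℂ) ≠ 0 := by exact_mod_cast Real.pi_ne_zero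
  have hI : Real.pi * Complex.I ≠ 0 := mul_ne_zero hpi Complex.I_ne_zero
  have : (α : ℂ) = β + 2 * n * m := by
    apply mul_left_cancel₀ hI
    have h2 : Real.pi * Complex.I * α = (Real.pi * Complex.I * α / n) * n := by
      field_simp
    rw [h2, hm]
    field_simp
  exact_mod_cast this

theorem exists_mul_num_eq_one (r : ℚ) : ∃ v : ZMod r.den, -(r.num : ZMod r.den) * v = 1 := by
  have hcop : IsCoprime (r.den : ℤ) r.num := by
    rw [Int.isCoprime_iff_gcd_eq_one, Int.gcd_comm]
    exact r.reduced
  obtain ⟨x, y, hxy⟩ := hcop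
  refine ⟨-(y : ZMod r.den), ?_⟩
  have := congrArg (Int.cast : ℤ → ZMod r.den) hxy
  push_cast at this
  rw [ZMod.natCast_self, mul_zero, zero_add] at this
  rw [neg_mul_neg, mul_comm, this]

/-- The dihedral group acts freely over the complement of the strings. -/
theorem toCover_mem_freeSet {x : (ℝ × ℝ) × I} (hx : TangleUnion.mk r x ∉ stringsUnion r) :
    toCover r x ∈ freeSet r := by
  obtain ⟨v, t⟩ := x
  have hfst : t ≠ 1 → ((1 - (t : ℝ) : ℝ) : ℂ) ≠ 0 := fun h => by
    rw [Complex.ofReal_ne_zero, sub_ne_zero]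
    exact fun h' => h (Subtype.ext h'.symm)
  have hsnd : t ≠ 0 → (((t : I) : ℝ) : ℂ) ≠ 0 := fun h => by
    rw [Complex.ofReal_ne_zero]
    exact fun h' => h (Subtype.ext h')
  rintro (i | i) hg
  · have h1 := congrArg Prod.fst hg
    have h2 := congrArg Prod.snd hg
    rw [smul_fst] at h1
    rw [smul_snd] at h2
    simp only [planeAct, one_mul] at h1 h2
    suffices i = 0 by rw [this, DihedralGroup.r_zero]
    by_cases ht : t = 1
    · have h0 : t ≠ 0 := by rw [ht]; exact one_ne_zero
      have : (toCover r (v, t)).2 ≠ 0 := mul_ne_zero (hsnd h0) (Complex.exp_ne_zero _)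
      have h3 := mul_right_cancel₀ this (h2.trans (one_mul _).symm)
      rw [← AddChar.map_zero_eq_one (ZMod.stdAddChar (N := r.den))] at h3
      have h4 := ZMod.injective_stdAddChar h3
      obtain ⟨w, hw⟩ := exists_mul_num_eq_one r
      rw [← one_mul i, ← hw, mul_right_comm, h4, zero_mul]
    · have : (toCover r (v, t)).1 ≠ 0 := mul_ne_zero (hfst ht) (Complex.exp_ne_zero _)
      have h3 := mul_right_cancel₀ this (h1.trans (one_mul _).symm)
      rw [← AddChar.map_zero_eq_one (ZMod.stdAddChar (N := r.den))] at h3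
      exact ZMod.injective_stdAddChar h3
  · exfalso
    obtain ⟨a, ha⟩ := ZMod.intCast_surjective (-i)
    rw [← neg_neg i, ← ha, ← toCover_sub v t a 0] at hg
    have h1 : t ≠ 1 → ∃ m : ℤ, v.1 = a - r.den * m := fun ht => by
      obtain ⟨m, hm⟩ := exists_int_of_exp_eq (mul_left_cancel₀ (hfst ht) (congrArg Prod.fst hg))
      exact ⟨m, by simp only at hm; linarith⟩
    have h2 : t ≠ 0 → ∃ l : ℤ, r.den * v.2 - r.num * v.1 = - r.num * a - r.den * l := fun ht => by
      obtain ⟨m, hm⟩ := exists_int_of_exp_eq (mul_left_cancel₀ (hsnd ht) (congrArg Prod.snd hg))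
      exact ⟨m, by simp only [Int.cast_zero] at hm; linarith⟩
    by_cases ht0 : t = 0
    · obtain ⟨m, hm⟩ := h1 (by rw [ht0]; exact zero_ne_one)
      subst ht0
      exact hx (mk_zero_mem_stringsUnion_iff.mpr ⟨a - r.den * m, by rw [hm]; push_cast; rfl⟩)
    obtain ⟨l, hl⟩ := h2 ht0
    by_cases ht1 : t = 1
    · subst ht1
      exact hx (mk_one_mem_stringsUnion_iff.mpr
        ⟨-r.num * a - r.den * l, by rw [hl]; push_cast; ring⟩)
    obtain ⟨m, hm⟩ := h1 ht1
    refine hx ((mk_mem_stringsUnion_iff ht0 ht1).mpr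
      ⟨a - r.den * m, - r.num * m - l, Prod.ext ?_ ?_⟩)
    · rw [hm]
      push_cast
      rfl
    · have hp : (r.den : ℝ) ≠ 0 := by exact_mod_cast r.den_nz
      rw [hm] at hl
      apply mul_left_cancel₀ hp
      push_cast
      linear_combination hl

end Model

/-! ### Meridians have reflections as holonomy -/

theorem Path.trans_apply_mem {Y : Type*} [TopologicalSpace Y] {a b c : Y} {γ : Path a b}
    {δ : Path b c} {S : Set Y} (hγ : ∀ t, γ t ∈ S) (hδ : ∀ t, δ t ∈ S) (t : I) :
    (γ.trans δ) t ∈ S := by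
  rw [Path.trans_apply]
  split_ifs
  · exact hγ _
  · exact hδ _

namespace TwoBridgeLink

variable {r : ℚ} (L : TwoBridgeLink r)

/-- The point of `S³` with given coordinates in `ℝ² × [0, 1]`. -/
def pt (x : (ℝ × ℝ) × I) : S3 := L.homeo (TangleUnion.mk r x)

theorem continuous_pt : Continuous L.pt := L.homeo.continuous.comp continuous_mk

theorem pt_surjective : Function.Surjective L.pt := L.homeo.surjective.comp mk_surjective

theorem pt_eq_iff {x y : (ℝ × ℝ) × I} : L.pt x = L.pt y ↔ GlueRel r x y :=
  L.homeo.injective.eq_iff.trans mk_eq_iff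

theorem pt_mem_link_iff {x : (ℝ × ℝ) × I} :
    L.pt x ∈ L.link ↔ TangleUnion.mk r x ∈ stringsUnion r :=
  L.homeo.injective.mem_set_image

theorem tangleToQuotient_mem_regularSet {y : S3} (hy : y ∈ (L.linkᶜ : Set S3)) :
    tangleToQuotient r (L.homeo.symm y) ∈ regularSet r := by
  obtain ⟨x, rfl⟩ := L.pt_surjective y
  rw [pt, L.homeo.symm_apply_apply, tangleToQuotient_mk, mem_regularSet_iff]
  exact toCover_mem_freeSet fun h => hy (L.pt_mem_link_iff.mpr h)

/-- The map of the link complement to the base of the dihedral covering. -/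
def complMap : C((L.linkᶜ : Set S3), regularSet r) where
  toFun y := ⟨tangleToQuotient r (L.homeo.symm y), L.tangleToQuotient_mem_regularSet y.2⟩
  continuous_toFun := (continuous_tangleToQuotient.comp
    (L.homeo.symm.continuous.comp continuous_subtype_val)).subtype_mk _

/-- The point of the dihedral covering with given coordinates in `ℝ² × [0, 1]`. -/
def liftPt (x : (ℝ × ℝ) × I) (hx : L.pt x ∈ (L.linkᶜ : Set S3)) : FreeCover r :=
  ⟨toCover r x, mem_regularSet_iff.mpr
    (toCover_mem_freeSet fun h => hx (L.pt_mem_link_iff.mpr h))⟩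

theorem coverProj_liftPt (x : (ℝ × ℝ) × I) (hx : L.pt x ∈ (L.linkᶜ : Set S3)) :
    coverProj r (L.liftPt x hx) = L.complMap ⟨L.pt x, hx⟩ := by
  apply Subtype.ext
  change Quotient.mk _ (toCover r x) = tangleToQuotient r (L.homeo.symm (L.homeo _))
  rw [L.homeo.symm_apply_apply]
  rfl

variable {L}

theorem pathLifts_of_coordinates {γ : I → (L.linkᶜ : Set S3)} {x : I → (ℝ × ℝ) × I}
    (hx : Continuous x) (h : ∀ t, (γ t : S3) = L.pt (x t)) :
    PathLifts (coverProj r) (fun t => L.complMap (γ t)) (L.liftPt (x 0) (h 0 ▸ (γ 0).2))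
      (L.liftPt (x 1) (h 1 ▸ (γ 1).2)) := by
  have hc : Continuous fun t => L.liftPt (x t) (h t ▸ (γ t).2) :=
    ((continuous_toCover r).comp hx).subtype_mk _
  exact ⟨⟨_, hc⟩, fun t => (L.coverProj_liftPt _ (h t ▸ (γ t).2)).trans
    (congrArg L.complMap (Subtype.ext (h t).symm)), rfl, rfl⟩

/-- Near every point of the link there is a loop which makes half a turn round a lattice point in
`ℝ²`; its holonomy is the corresponding reflection. -/
theorem exists_loop_of_mem_link {x : S3} (hx : x ∈ L.link) {U : Set S3} (hU : IsOpen U)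
    (hxU : x ∈ U) : ∃ (c : (L.linkᶜ : Set S3)) (γ : Path c c) (z : FreeCover r)
      (i : ZMod r.den), (∀ t, (γ t : S3) ∈ U) ∧
      PathLifts (coverProj r) (fun t => L.complMap (γ t)) z (DihedralGroup.sr i • z) := by
  obtain ⟨_, ⟨a, b, t, rfl⟩, rfl⟩ := hx
  have hO : IsOpen (L.pt ⁻¹' U) := hU.preimage L.continuous_pt
  -- move away from the two cores
  obtain ⟨t', ht'U, ht'⟩ : ∃ t' : I, L.pt ((a, b), t') ∈ U ∧ t' ∈ Set.Ioo (0 : I) 1 := by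
    have hd : Dense (Set.Ioo (0 : I) 1) := by
      intro s
      rw [closure_Ioo zero_ne_one]
      exact ⟨s.2.1, s.2.2⟩
    exact hd.inter_open_nonempty _ (hO.preimage (by fun_prop : Continuous
      fun s : I => ((((a : ℝ), (b : ℝ)), s) : (ℝ × ℝ) × I))) ⟨t, hxU⟩
  obtain ⟨ε, hε, hball⟩ := Metric.isOpen_iff.mp (hO.preimage (by fun_prop : Continuous
      fun v : ℝ × ℝ => ((v, t') : (ℝ × ℝ) × I))) ((a : ℝ), (b : ℝ)) ht'U
  obtain ⟨δ, hδ0, hδε, hδ1⟩ : ∃ δ : ℝ, 0 < δ ∧ δ < ε ∧ δ < 1 :=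
    ⟨min ε 1 / 2, by positivity, by linarith [min_le_left ε 1, lt_min hε one_pos],
      by linarith [min_le_right ε 1, lt_min hε one_pos]⟩
  set v : I → ℝ × ℝ := fun u =>
    (a + δ * Real.cos (Real.pi * (u : ℝ)), b + δ * Real.sin (Real.pi * (u : ℝ))) with hv
  have hvc : Continuous fun u => ((v u, t') : (ℝ × ℝ) × I) := by fun_prop
  have hvK : ∀ u, L.pt (v u, t') ∈ (L.linkᶜ : Set S3) := by
    intro u h
    rw [pt_mem_link_iff, mk_mem_stringsUnion_iff ht'.1.ne' ht'.2.ne] at h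
    obtain ⟨a', b', h⟩ := h
    have h1 := congrArg Prod.fst h
    have h2 := congrArg Prod.snd h
    simp only [hv] at h1 h2
    have key : ∀ (m : ℤ) (w : ℝ), δ * w = m → |w| ≤ 1 → w = 0 := by
      intro m w hm hw
      have : |(m : ℝ)| < 1 := by
        rw [← hm, abs_mul, abs_of_pos hδ0]
        nlinarith [abs_nonneg w]
      have hm0 : m = 0 := Int.abs_lt_one_iff.mp (by exact_mod_cast this)
      rw [hm0, Int.cast_zero] at hm
      exact (mul_eq_zero.mp hm).resolve_left hδ0.ne'
    have k1 := key (a' - a) _ (by push_cast; linarith) (Real.abs_cos_le_one (Real.pi * (u : ℝ)))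
    have k2 := key (b' - b) _ (by push_cast; linarith) (Real.abs_sin_le_one (Real.pi * (u : ℝ)))
    have := Real.sin_sq_add_cos_sq (Real.pi * (u : ℝ))
    rw [k1, k2] at this
    norm_num at this
  have hv1 : v 1 = (2 * a - (v 0).1, 2 * b - (v 0).2) := by
    simp only [hv]
    norm_num
    constructor <;> ring
  let γ : Path (⟨L.pt (v 0, t'), hvK 0⟩ : (L.linkᶜ : Set S3)) ⟨L.pt (v 0, t'), hvK 0⟩ :=
    { toFun := fun u => ⟨L.pt (v u, t'), hvK u⟩
      continuous_toFun := (L.continuous_pt.comp hvc).subtype_mk _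
      source' := rfl
      target' := by
        apply Subtype.ext
        refine L.pt_eq_iff.mpr ⟨rfl, Or.inl (PillowRel.symm ⟨a, b, Or.inr ?_⟩)⟩
        exact hv1 }
  refine ⟨_, γ, L.liftPt (v 0, t') (hvK 0), -(a : ZMod r.den), fun u => ?_, ?_⟩
  · refine hball (a := v u) ?_
    simp only [hv, Metric.mem_ball, Prod.dist_eq, Real.dist_eq, add_sub_cancel_left, abs_mul,
      abs_of_pos hδ0, max_lt_iff]
    constructor
    · nlinarith [Real.abs_cos_le_one (Real.pi * (u : ℝ))]
    · nlinarith [Real.abs_sin_le_one (Real.pi * (u : ℝ))]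
  · have := pathLifts_of_coordinates (L := L) (γ := γ) hvc fun u => rfl
    convert this using 1
    apply Subtype.ext
    change _ = toCover r (v 1, t')
    rw [hv1, toCover_sub]
    rfl

/-- The holonomy of the standard loop of a straightening chart is a reflection. -/
theorem parity_loop (e : StraighteningChart L.link) {c : (L.linkᶜ : Set S3)}
    (hc : (c : S3) ∈ e.chart.source) {z : FreeCover r} {g : DihedralGroup r.den}
    (h : PathLifts (coverProj r) (fun t => L.complMap (e.loop c hc t)) z (g • z)) :
    parity g = Multiplicative.ofAdd 1 := by
  have hπ := isQuotientCoveringMap_coverProj (r := r)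
  obtain ⟨c', γ, z', i, hγ, hz'⟩ := exists_loop_of_mem_link (L := L)
    (x := e.chart.symm (0, 0)) ((e.symm_mem_iff _).mpr rfl) e.chart.open_source
    (e.chart.map_target (e.mem_target _))
  have hc' : (c' : S3) ∈ e.chart.source := by simpa using hγ 0
  obtain ⟨δ, hδ⟩ := e.exists_path hc hc'
  obtain ⟨z₁, hz₁⟩ := PathLifts.exists hπ.isCoveringMap (γ := fun t => L.complMap (δ t))
    (by fun_prop) (e := z) (by rw [h.apply_left, (e.loop c hc).source, δ.source])
  obtain ⟨k, hk⟩ := hπ.apply_eq_iff_mem_orbit.mp (hz₁.apply_right.trans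
    (show L.complMap (δ 1) = coverProj r z' by rw [hz'.apply_left, δ.target, γ.source]))
  replace hk : k • z' = z₁ := hk
  have h₁ : PathLifts (coverProj r) (fun t => L.complMap (γ t)) z₁
      ((k * .sr i * k⁻¹) • z₁) := by
    have := hz'.smul hπ k
    rwa [hk, ← mul_smul, ← inv_smul_eq_iff.mpr hk.symm, ← mul_smul] at this
  obtain ⟨n, hn⟩ := e.exists_zpow_of_forall_mem_source hπ L.complMap hc h
    ((δ.trans γ).trans δ.symm) (fun t => by
      exact Path.trans_apply_mem (S := Subtype.val ⁻¹' e.chart.source)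
        (Path.trans_apply_mem hδ hγ) (fun t => hδ _) t) (PathLifts.conj hπ hz₁ h₁)
  refine parity_of_zpow ?_ hn
  rw [map_mul, map_mul, map_inv, mul_comm, inv_mul_cancel_left, parity_sr]

end TwoBridgeLink

/-! ### Dihedral representations and the homology of the double branched covering -/

/-- The index of a rotation or reflection in the dihedral group. -/
def dihedralIndex {n : ℕ} : DihedralGroup n → ZMod n
  | .r i => i
  | .sr i => i

theorem eq_r_of_parity {n : ℕ} {g : DihedralGroup n} (h : parity g = 1) :
    g = .r (dihedralIndex g) := by
  rcases g with i | i
  · rfl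
  · exact absurd (show Multiplicative.ofAdd (1 : ZMod 2) = 1 from h) (by decide)

/-- A homomorphism to the dihedral group with values in the rotations, as a homomorphism to the
cyclic group of rotations. -/
def rotationHom {H : Type*} [Group H] {n : ℕ} (θ : H →* DihedralGroup n)
    (hθ : ∀ x, parity (θ x) = 1) : H →* Multiplicative (ZMod n) where
  toFun x := Multiplicative.ofAdd (dihedralIndex (θ x))
  map_one' := by
    rw [map_one]
    rfl
  map_mul' x y := by
    rw [map_mul, eq_r_of_parity (hθ x), eq_r_of_parity (hθ y), DihedralGroup.r_mul_r]
    rfl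

section

variable {X : Type} [TopologicalSpace X] {K : Set X} {b : (Kᶜ : Set X)} {n : ℕ}

/-- A dihedral representation which sends the meridians to reflections factors through the
`π`-orbifold group. -/
def orbifoldHom (φ : LinkGroup K b →* DihedralGroup n)
    (hφ : ∀ m, IsMeridian m → parity (φ m) = Multiplicative.ofAdd 1) :
    OrbifoldGroup K b →* DihedralGroup n :=
  QuotientGroup.lift (meridianSquares K b) φ <| by
    refine Subgroup.normalClosure_le_normal ?_
    rintro _ ⟨m, hm, rfl⟩
    change φ (m ^ 2) = 1
    rw [map_pow, pow_two]
    exact mul_self_of_parity (hφ m hm)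

theorem parity_orbifoldHom (φ : LinkGroup K b →* DihedralGroup n)
    (hφ : ∀ m, IsMeridian m → parity (φ m) = Multiplicative.ofAdd 1)
    (x : doubleCoverGroup K b) : parity (orbifoldHom φ hφ x) = 1 := by
  have hx := x.2
  simp only [doubleCoverGroup, Subgroup.mem_iInf] at hx
  exact hx (parity.comp (orbifoldHom φ hφ)) fun m hm => hφ m hm

/-- If two dihedral representations, both sending meridians to reflections, agree on a product of two
meridians whose class generates the homology of the double branched covering, they agree on all
products of two meridians: the rotation subgroup is commutative. -/
theorem eq_of_forall_mem_zpowers_omega {m₁ m₂ : LinkGroup K b} (h₁ : IsMeridian m₁)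
    (h₂ : IsMeridian m₂) {φ ψ : LinkGroup K b →* DihedralGroup n}
    (hφ : ∀ m, IsMeridian m → parity (φ m) = Multiplicative.ofAdd 1)
    (hψ : ∀ m, IsMeridian m → parity (ψ m) = Multiplicative.ofAdd 1)
    (h : φ (m₁ * m₂) = ψ (m₁ * m₂))
    (hgen : ∀ x : H1DoubleCover K b, x ∈ Subgroup.zpowers (omega h₁ h₂))
    {m m' : LinkGroup K b} (hm : IsMeridian m) (hm' : IsMeridian m') :
    φ (m * m') = ψ (m * m') := by
  let χ : ∀ θ : LinkGroup K b →* DihedralGroup n,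
      (∀ m, IsMeridian m → parity (θ m) = Multiplicative.ofAdd 1) →
      (H1DoubleCover K b →* Multiplicative (ZMod n)) := fun θ hθ =>
    Abelianization.lift (rotationHom ((orbifoldHom θ hθ).comp (doubleCoverGroup K b).subtype)
      (parity_orbifoldHom θ hθ))
  have hval : ∀ θ hθ {m m' : LinkGroup K b} (hm : IsMeridian m) (hm' : IsMeridian m'),
      χ θ hθ (omega hm hm') = Multiplicative.ofAdd (dihedralIndex (θ (m * m'))) :=
    fun θ hθ m m' hm hm' => Abelianization.lift_apply_of _ _
  have hχ : χ φ hφ = χ ψ hψ := by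
    refine MonoidHom.ext fun x => ?_
    obtain ⟨k, rfl⟩ := Subgroup.mem_zpowers_iff.mp (hgen x)
    rw [map_zpow, map_zpow, hval, hval, h]
  have hpar : ∀ θ : LinkGroup K b →* DihedralGroup n,
      (∀ m, IsMeridian m → parity (θ m) = Multiplicative.ofAdd 1) → parity (θ (m * m')) = 1 := by
    intro θ hθ
    rw [map_mul, map_mul, hθ m hm, hθ m' hm']
    decide
  have := DFunLike.congr_fun hχ (omega hm hm')
  rw [hval, hval] at this
  rw [eq_r_of_parity (hpar φ hφ), eq_r_of_parity (hpar ψ hψ), Multiplicative.ofAdd.injective this]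

end

namespace TwoBridgeLink

variable {r : ℚ} {L : TwoBridgeLink r}

/-! ### Homeomorphisms of the pair `(S³, K(r))` -/

theorem mem_link_of_image_eq {h : S3 ≃ₜ S3} (hK : h '' L.link = L.link) {x : S3} :
    h x ∈ L.link ↔ x ∈ L.link := by
  conv_lhs => rw [← hK]
  exact h.injective.mem_set_image

/-- The restriction of a homeomorphism of the pair `(S³, K(r))` to the link complement. -/
def complHomeo (h : S3 ≃ₜ S3) (hK : h '' L.link = L.link) :
    C((L.linkᶜ : Set S3), (L.linkᶜ : Set S3)) where
  toFun y := ⟨h y, fun k => y.2 ((mem_link_of_image_eq hK).mp k)⟩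
  continuous_toFun := (h.continuous.comp continuous_subtype_val).subtype_mk _

theorem parity_complHomeo_loop (h : S3 ≃ₜ S3) (hK : h '' L.link = L.link)
    (e : StraighteningChart L.link) {c : (L.linkᶜ : Set S3)}
    (hc : (c : S3) ∈ e.chart.source) {z : FreeCover r} {g : DihedralGroup r.den}
    (hg : PathLifts (coverProj r) (fun t => L.complMap (complHomeo h hK (e.loop c hc t))) z
      (g • z)) : parity g = Multiplicative.ofAdd 1 := by
  have hc' : (complHomeo h hK c : S3) ∈ (e.map h hK).chart.source := by
    rw [e.mem_map_source]
    change h.symm (h c) ∈ _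
    rwa [h.symm_apply_apply]
  refine parity_loop (e.map h hK) hc' (z := z) ?_
  convert hg using 3 with t
  exact Subtype.ext (e.map_loop h hK hc hc' rfl t)

/-- Let `α` be an arc which starts on the link and is fixed pointwise by a homeomorphism `h` of the
pair.  The standard loop of a chart containing `α` and its image under `h` have the same holonomy:
the holonomy of a small loop at the start of `α`, dragged along `α`, is a reflection and a power of
each of the two. -/
theorem holonomy_eq_of_fixed_arc (h : S3 ≃ₜ S3) (hK : h '' L.link = L.link)
    (e : StraighteningChart L.link) {α : I → S3} (hα : Continuous α) (hα0 : α 0 ∈ L.link)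
    (hαK : ∀ t, t ≠ 0 → α t ∉ L.link) (hαe : ∀ t, α t ∈ e.chart.source)
    (hfix : ∀ t, h (α t) = α t) {c : (L.linkᶜ : Set S3)} (hc : (c : S3) = α 1)
    (hce : (c : S3) ∈ e.chart.source) {z : FreeCover r} {g g' : DihedralGroup r.den}
    (hg : PathLifts (coverProj r) (fun t => L.complMap (e.loop c hce t)) z (g • z))
    (hg' : PathLifts (coverProj r) (fun t => L.complMap (complHomeo h hK (e.loop c hce t))) z
      (g' • z)) : g = g' := by
  have hπ := isQuotientCoveringMap_coverProj (r := r)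
  have hsymm : ∀ t, h.symm (α t) = α t := fun t => by rw [h.symm_apply_eq, hfix]
  set e' := e.map h hK with he'
  have hαe' : ∀ t, α t ∈ e'.chart.source := fun t => by
    rw [he', e.mem_map_source, hsymm]
    exact hαe t
  have hce' : (c : S3) ∈ e'.chart.source := hc ▸ hαe' 1
  -- a small loop at a point of the arc close to its start
  obtain ⟨t₀, ht₀, ht₀0⟩ : ∃ t₀ : I, (∀ k : α t₀ ∈ (L.linkᶜ : Set S3),
      ∃ hc : α t₀ ∈ e.chart.source, ∀ t, (e.loop ⟨α t₀, k⟩ hc t : S3) ∈ e'.chart.source) ∧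
      t₀ ≠ 0 := by
    have h1 := hα.continuousAt (x := 0) |>.eventually (e.eventually_loop_mem (hαe 0) hα0
      (e'.chart.open_source.mem_nhds (hαe' 0)))
    have h2 : ∀ᶠ t in 𝓝[≠] (0 : I), t ≠ 0 := eventually_mem_nhdsWithin
    exact ((h1.filter_mono nhdsWithin_le_nhds).and h2).exists
  obtain ⟨hs, hloop⟩ := ht₀ (hαK t₀ ht₀0)
  set c₀ : (L.linkᶜ : Set S3) := ⟨α t₀, hαK t₀ ht₀0⟩ with hc₀
  -- the arc from its end back to this point
  have hpos : ∀ t : I, max t₀ (σ t) ≠ 0 := fun t =>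
    ((unitInterval.pos_iff_ne_zero.mpr ht₀0).trans_le (le_max_left _ _)).ne'
  let δ : Path c c₀ :=
    { toFun := fun t => ⟨α (max t₀ (σ t)), hαK _ (hpos t)⟩
      continuous_toFun := (hα.comp (by fun_prop)).subtype_mk _
      source' := Subtype.ext (by simp [hc, max_eq_right (unitInterval.le_one' (t := t₀))])
      target' := Subtype.ext (by simp [hc₀]) }
  obtain ⟨z₁, hz₁⟩ := PathLifts.exists hπ.isCoveringMap (γ := fun t => L.complMap (δ t))
    (by fun_prop) (e := z) (by rw [hg.apply_left, (e.loop c hce).source, δ.source])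
  obtain ⟨k, hk⟩ := PathLifts.exists_smul hπ (γ := fun t => L.complMap (e.loop c₀ hs t))
    (by fun_prop) (by rw [(e.loop c₀ hs).source, (e.loop c₀ hs).target])
    (e := z₁) (by rw [hz₁.apply_right, δ.target, (e.loop c₀ hs).source])
  have hkp := parity_loop e hs hk
  have hγ := PathLifts.conj hπ hz₁ hk
  obtain ⟨n, hn⟩ := e.exists_zpow_of_forall_mem_source hπ L.complMap hce hg _
    (Path.trans_apply_mem (S := Subtype.val ⁻¹' e.chart.source)
      (Path.trans_apply_mem (fun t => hαe _) (e.loop_mem_source hs)) (fun t => hαe _)) hγ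
  have hg'' : PathLifts (coverProj r) (fun t => L.complMap (e'.loop c hce' t)) z (g' • z) := by
    convert hg' using 3 with t
    exact Subtype.ext (e.map_loop h hK hce hce' (by rw [hc, hfix]) t)
  obtain ⟨n', hn'⟩ := e'.exists_zpow_of_forall_mem_source hπ L.complMap hce' hg'' _
    (Path.trans_apply_mem (S := Subtype.val ⁻¹' e'.chart.source)
      (Path.trans_apply_mem (fun t => hαe' _) hloop) (fun t => hαe' _)) hγ
  rw [← eq_of_zpow_of_parity (parity_loop e hce hg) hkp hn,
    ← eq_of_zpow_of_parity (parity_loop e' hce' hg'') hkp hn']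

end TwoBridgeLink

/-! ### Straightening charts along the strings -/

section StringChart

variable {r : ℚ}

/-- Away from the two cores, the projection to the union of the tangles is open. -/
theorem isOpen_image_mk {W : Set ((ℝ × ℝ) × I)} (hW : IsOpen W)
    (hW' : ∀ x ∈ W, x.2 ≠ 0 ∧ x.2 ≠ 1) : IsOpen (TangleUnion.mk r '' W) := by
  have hpre : TangleUnion.mk r ⁻¹' (TangleUnion.mk r '' W) =
      ⋃ a : ℤ, ⋃ b : ℤ,
        ((fun x : (ℝ × ℝ) × I => ((x.1.1 + 2 * a, x.1.2 + 2 * b), x.2)) ⁻¹' W ∪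
          (fun x : (ℝ × ℝ) × I => ((2 * a - x.1.1, 2 * b - x.1.2), x.2)) ⁻¹' W) := by
    ext ⟨v, t⟩
    simp only [Set.mem_preimage, Set.mem_image, Set.mem_iUnion, Set.mem_union]
    constructor
    · rintro ⟨⟨w, s⟩, hw, h⟩
      obtain ⟨hs, h | ⟨h, -⟩ | ⟨h, -⟩⟩ := mk_eq_iff.mp h.symm
      · obtain rfl : t = s := hs
        obtain ⟨a, b, h | h⟩ := h
        · exact ⟨a, b, Or.inl (by rwa [← h])⟩
        · exact ⟨a, b, Or.inr (by rwa [← h])⟩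
      · exact absurd (hs.symm.trans h) (hW' _ hw).1
      · exact absurd (hs.symm.trans h) (hW' _ hw).2
    · rintro ⟨a, b, h | h⟩
      · exact ⟨_, h, mk_eq_iff.mpr ⟨rfl, Or.inl (PillowRel.symm ⟨a, b, Or.inl rfl⟩)⟩⟩
      · exact ⟨_, h, mk_eq_iff.mpr ⟨rfl, Or.inl (PillowRel.symm ⟨a, b, Or.inr rfl⟩)⟩⟩
  have hquot : IsOpen (TangleUnion.mk r ⁻¹' (TangleUnion.mk r '' W)) := by
    rw [hpre]
    exact isOpen_iUnion fun a => isOpen_iUnion fun b =>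
      (hW.preimage (by fun_prop)).union (hW.preimage (by fun_prop))
  exact hquot

/-- The branched double covering `ℂ × ℝ → TangleUnion r` of a tubular neighbourhood of the open string
over the lattice point `(a, b)`, branched along the string. -/
def stringTube (r : ℚ) (a b : ℤ) (y : ℂ × ℝ) : TangleUnion r :=
  TangleUnion.mk r ((a + (OpenPartialHomeomorph.univUnitBall y.1).re,
    b + (OpenPartialHomeomorph.univUnitBall y.1).im), unitInterval.sigmoid y.2)

theorem continuous_univUnitBall : Continuous (OpenPartialHomeomorph.univUnitBall : ℂ → ℂ) :=
  continuousOn_univ.mp OpenPartialHomeomorph.univUnitBall.continuousOn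

theorem univUnitBall_mul {u : ℂ} (hu : ‖u‖ = 1) (z : ℂ) :
    OpenPartialHomeomorph.univUnitBall (u * z) = u * OpenPartialHomeomorph.univUnitBall z := by
  rw [OpenPartialHomeomorph.univUnitBall_apply, OpenPartialHomeomorph.univUnitBall_apply, norm_mul,
    hu, one_mul, mul_smul_comm]

theorem univUnitBall_injective :
    Function.Injective (OpenPartialHomeomorph.univUnitBall : ℂ → ℂ) := fun z w h =>
  OpenPartialHomeomorph.univUnitBall.injOn (Set.mem_univ z) (Set.mem_univ w) h

theorem norm_univUnitBall_lt (z : ℂ) : ‖(OpenPartialHomeomorph.univUnitBall z : ℂ)‖ < 1 := by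
  have := OpenPartialHomeomorph.univUnitBall.map_source (Set.mem_univ z)
  rwa [OpenPartialHomeomorph.univUnitBall_target, mem_ball_zero_iff] at this

variable {a b : ℤ}

theorem continuous_stringTube : Continuous (stringTube r a b) := by
  have := continuous_univUnitBall
  have := unitInterval.continuous_sigmoid
  refine continuous_mk.comp ?_
  fun_prop

theorem stringTube_eq_iff {z w : ℂ} {s t : ℝ} :
    stringTube r a b (z, s) = stringTube r a b (w, t) ↔ s = t ∧ (z = w ∨ z = -w) := by
  have hs : ∀ s, unitInterval.sigmoid s ≠ 0 ∧ unitInterval.sigmoid s ≠ 1 := fun s =>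
    ⟨(unitInterval.sigmoid_pos s).ne', (unitInterval.sigmoid_lt_one s).ne⟩
  have hneg : ∀ z : ℂ, OpenPartialHomeomorph.univUnitBall (-z) =
      -OpenPartialHomeomorph.univUnitBall z := fun z => by
    simpa using univUnitBall_mul (u := -1) (by simp) z
  constructor
  · intro h
    obtain ⟨h1, h | ⟨h, -⟩ | ⟨h, -⟩⟩ := mk_eq_iff.mp h
    · refine ⟨unitInterval.sigmoid_injective h1, ?_⟩
      have hz := norm_univUnitBall_lt z
      have hw := norm_univUnitBall_lt w
      have hz1 := abs_lt.mp ((Complex.abs_re_le_norm _).trans_lt hz)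
      have hz2 := abs_lt.mp ((Complex.abs_im_le_norm _).trans_lt hz)
      have hw1 := abs_lt.mp ((Complex.abs_re_le_norm _).trans_lt hw)
      have hw2 := abs_lt.mp ((Complex.abs_im_le_norm _).trans_lt hw)
      -- a translation or rotation in `𝒥` carrying the open unit disc about `(a, b)` to a set which
      -- meets this disc fixes the centre
      have key : ∀ m : ℤ, (-1 : ℝ) < m → (m : ℝ) < 1 → m = 0 := fun m h1 h2 => by
        have h1' : -1 < m := by exact_mod_cast h1
        have h2' : m < 1 := by exact_mod_cast h2
        omega
      obtain ⟨c, d, h | h⟩ := h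
      · left
        have e1 := congrArg Prod.fst h
        have e2 := congrArg Prod.snd h
        simp only at e1 e2
        have hc := key c (by linarith) (by linarith)
        have hd := key d (by linarith) (by linarith)
        rw [hc, Int.cast_zero] at e1
        rw [hd, Int.cast_zero] at e2
        exact univUnitBall_injective (Complex.ext (by linarith) (by linarith))
      · right
        have e1 := congrArg Prod.fst h
        have e2 := congrArg Prod.snd h
        simp only at e1 e2
        have hc := key (c - a) (by push_cast; linarith) (by push_cast; linarith)
        have hd := key (d - b) (by push_cast; linarith) (by push_cast; linarith)
        have hc' : (c : ℝ) = a := by exact_mod_cast sub_eq_zero.mp hc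
        have hd' : (d : ℝ) = b := by exact_mod_cast sub_eq_zero.mp hd
        rw [hc'] at e1
        rw [hd'] at e2
        apply univUnitBall_injective
        rw [hneg]
        exact Complex.ext (by rw [Complex.neg_re]; linarith) (by rw [Complex.neg_im]; linarith)
    · exact absurd h (hs s).1
    · exact absurd h (hs s).2
  · rintro ⟨rfl, rfl | rfl⟩
    · rfl
    · refine mk_eq_iff.mpr ⟨rfl, Or.inl ⟨a, b, Or.inr ?_⟩⟩
      simp only [hneg, Complex.neg_re, Complex.neg_im]
      ext <;> ring

theorem isOpenMap_stringTube : IsOpenMap (stringTube r a b) := by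
  intro A hA
  have hopen : IsOpenMap fun y : ℂ × ℝ => (((a + (OpenPartialHomeomorph.univUnitBall y.1).re,
      b + (OpenPartialHomeomorph.univUnitBall y.1).im), unitInterval.sigmoid y.2) :
        (ℝ × ℝ) × I) := by
    have h1 : IsOpenMap (OpenPartialHomeomorph.univUnitBall : ℂ → ℂ) := fun B hB =>
      OpenPartialHomeomorph.univUnitBall.isOpen_image_of_subset_source hB
        (Set.subset_univ _)
    have h2 : IsOpenMap unitInterval.sigmoid := Topology.IsOpenEmbedding.isOpenMap
      ⟨Topology.isEmbedding_sigmoid, by rw [unitInterval.range_sigmoid]; exact isOpen_Ioo⟩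
    have h3 : IsOpenMap fun z : ℂ => ((a + z.re, b + z.im) : ℝ × ℝ) :=
      (Complex.equivRealProdCLM.toHomeomorph.trans
        ((Homeomorph.addLeft (a : ℝ)).prodCongr (Homeomorph.addLeft (b : ℝ)))).isOpenMap
    exact (h3.comp h1).prodMap h2
  have := isOpen_image_mk (r := r) (hopen A hA) (by
    rintro _ ⟨y, -, rfl⟩
    exact ⟨(unitInterval.sigmoid_pos _).ne', (unitInterval.sigmoid_lt_one _).ne⟩)
  rwa [← Set.image_comp] at this

/-- A square root in `ℂ`. -/
def someSqrt (w : ℂ) : ℂ := w ^ ((2 : ℕ) : ℂ)⁻¹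

theorem someSqrt_sq (w : ℂ) : someSqrt w ^ 2 = w := Complex.cpow_nat_inv_pow w two_ne_zero

theorem stringTube_someSqrt (z : ℂ) (s : ℝ) :
    stringTube r a b (someSqrt (z ^ 2), s) = stringTube r a b (z, s) :=
  stringTube_eq_iff.mpr ⟨rfl, sq_eq_sq_iff_eq_or_eq_neg.mp (someSqrt_sq _)⟩

theorem isOpenQuotientMap_sq :
    IsOpenQuotientMap (Prod.map (fun z : ℂ => z ^ 2) (id : ℝ → ℝ)) :=
  (Complex.isOpenQuotientMap_pow 2).prodMap .id

variable (r a b) in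
theorem isOpenEmbedding_stringTube_someSqrt :
    Topology.IsOpenEmbedding fun y : ℂ × ℝ => stringTube r a b (someSqrt y.1, y.2) := by
  have hcomp : (fun y : ℂ × ℝ => stringTube r a b (someSqrt y.1, y.2)) ∘
      Prod.map (fun z : ℂ => z ^ 2) (id : ℝ → ℝ) = stringTube r a b :=
    funext fun y => stringTube_someSqrt y.1 y.2
  refine .of_continuous_injective_isOpenMap ?_ ?_ ?_
  · rw [isOpenQuotientMap_sq.isQuotientMap.continuous_iff, hcomp]
    exact continuous_stringTube
  · rintro ⟨w, s⟩ ⟨w', s'⟩ h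
    obtain ⟨rfl, h⟩ := stringTube_eq_iff.mp h
    rw [← someSqrt_sq w, ← someSqrt_sq w', sq_eq_sq_iff_eq_or_eq_neg.mpr h]
  · intro A hA
    have := isOpenMap_stringTube (r := r) (a := a) (b := b) _
      (hA.preimage isOpenQuotientMap_sq.continuous)
    rwa [← hcomp, Set.image_comp, Set.image_preimage_eq _ isOpenQuotientMap_sq.surjective] at this

variable (r a b) in
/-- The straightening chart along the open string over the lattice point `(a, b)`, given by the square
of the complex coordinate centred at `(a, b)`. -/
def stringChart : StraighteningChart (stringsUnion r) where
  chart := ((isOpenEmbedding_stringTube_someSqrt r a b).toOpenPartialHomeomorph _).symm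
  target_eq := by simp
  mem_iff := by
    intro x hx
    obtain ⟨⟨w, s⟩, rfl⟩ : x ∈ Set.range fun y : ℂ × ℝ => stringTube r a b (someSqrt y.1, y.2) := by
      simpa using hx
    have h2 : (((isOpenEmbedding_stringTube_someSqrt r a b).toOpenPartialHomeomorph _).symm
        (stringTube r a b (someSqrt w, s))) = (w, s) :=
      ((isOpenEmbedding_stringTube_someSqrt r a b).toOpenPartialHomeomorph _).left_inv
        (x := (w, s)) (by simp)
    rw [h2]
    have hs : unitInterval.sigmoid s ≠ 0 ∧ unitInterval.sigmoid s ≠ 1 :=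
      ⟨(unitInterval.sigmoid_pos s).ne', (unitInterval.sigmoid_lt_one s).ne⟩
    have hz := norm_univUnitBall_lt (someSqrt w)
    constructor
    · intro h
      obtain ⟨c, d, h⟩ := (mk_mem_stringsUnion_iff hs.1 hs.2).mp h
      have e1 := congrArg Prod.fst h
      have e2 := congrArg Prod.snd h
      simp only at e1 e2
      have key : ∀ m : ℤ, |(m : ℝ)| < 1 → (m : ℝ) = 0 := fun m h1 => by
        have : |m| < 1 := by exact_mod_cast h1
        exact_mod_cast Int.abs_lt_one_iff.mp this
      have k1 := key (c - a) (by
        push_cast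
        rw [← e1, add_sub_cancel_left]
        exact (Complex.abs_re_le_norm _).trans_lt hz)
      have k2 := key (d - b) (by
        push_cast
        rw [← e2, add_sub_cancel_left]
        exact (Complex.abs_im_le_norm _).trans_lt hz)
      push_cast at k1 k2
      have : (OpenPartialHomeomorph.univUnitBall (someSqrt w) : ℂ) = 0 :=
        Complex.ext (by rw [Complex.zero_re]; linarith) (by rw [Complex.zero_im]; linarith)
      rw [← OpenPartialHomeomorph.univUnitBall_apply_zero] at this
      have h0 := univUnitBall_injective this
      rw [← someSqrt_sq w, h0, zero_pow two_ne_zero]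
    · intro h
      have h0 : someSqrt w = 0 := by
        rw [← sq_eq_zero_iff, someSqrt_sq]
        exact h
      refine (mk_mem_stringsUnion_iff hs.1 hs.2).mpr ⟨a, b, ?_⟩
      simp [h0, OpenPartialHomeomorph.univUnitBall_apply_zero]

theorem stringTube_mem_source (z : ℂ) (s : ℝ) :
    stringTube r a b (z, s) ∈ (stringChart r a b).chart.source := by
  rw [← stringTube_someSqrt]
  change _ ∈ ((isOpenEmbedding_stringTube_someSqrt r a b).toOpenPartialHomeomorph _).target
  simp

theorem stringChart_stringTube (z : ℂ) (s : ℝ) :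
    (stringChart r a b).chart (stringTube r a b (z, s)) = (z ^ 2, s) := by
  rw [← stringTube_someSqrt]
  exact ((isOpenEmbedding_stringTube_someSqrt r a b).toOpenPartialHomeomorph _).left_inv
    (x := (z ^ 2, s)) (by simp)

/-- The standard loops of `stringChart` make half a turn round a lattice point of `ℝ²`. -/
theorem stringChart_loop {δ : ℝ} (hδ0 : 0 < δ) (hδ1 : δ < 1) {t : I} (ht0 : 0 < t) (ht1 : t < 1)
    (c : ((stringsUnion r)ᶜ : Set (TangleUnion r)))
    (hc : (c : TangleUnion r) = TangleUnion.mk r ((a + δ, b), t)) :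
    ∃ h : (c : TangleUnion r) ∈ (stringChart r a b).chart.source, ∀ u : I,
      ((stringChart r a b).loop c h u : TangleUnion r) = TangleUnion.mk r
        ((a + δ * Real.cos (Real.pi * (u : ℝ)), b + δ * Real.sin (Real.pi * (u : ℝ))), t) := by
  obtain ⟨s, rfl⟩ : t ∈ Set.range unitInterval.sigmoid := by
    rw [unitInterval.range_sigmoid]
    exact ⟨ht0, ht1⟩
  obtain ⟨z, hz⟩ : ∃ z : ℂ, OpenPartialHomeomorph.univUnitBall z = (δ : ℂ) :=
    ⟨_, OpenPartialHomeomorph.univUnitBall.right_inv (x := (δ : ℂ)) (by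
      rw [OpenPartialHomeomorph.univUnitBall_target, mem_ball_zero_iff, Complex.norm_real,
        Real.norm_of_nonneg hδ0.le]
      exact hδ1)⟩
  have hcz : (c : TangleUnion r) = stringTube r a b (z, s) := by
    rw [hc, stringTube, hz, Complex.ofReal_re, Complex.ofReal_im, add_zero]
  have hmem : (c : TangleUnion r) ∈ (stringChart r a b).chart.source :=
    hcz ▸ stringTube_mem_source z s
  refine ⟨hmem, fun u => ?_⟩
  change stringTube r a b (someSqrt (_ * ((stringChart r a b).chart c).1),
    ((stringChart r a b).chart c).2) = _
  rw [hcz, stringChart_stringTube]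
  simp only
  have he : Complex.exp (2 * Real.pi * Complex.I * ((u : ℝ) : ℂ)) * z ^ 2 =
      (Complex.exp (((Real.pi * (u : ℝ) : ℝ) : ℂ) * Complex.I) * z) ^ 2 := by
    rw [mul_pow, ← Complex.exp_nat_mul]
    congr 2
    push_cast
    ring
  rw [he, stringTube_someSqrt, stringTube, univUnitBall_mul (Complex.norm_exp_ofReal_mul_I _), hz]
  rw [Complex.re_mul_ofReal, Complex.im_mul_ofReal, Complex.exp_ofReal_mul_I_re,
    Complex.exp_ofReal_mul_I_im, mul_comm δ, mul_comm δ]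

end StringChart

namespace TwoBridgeLink

variable {r : ℚ} {L : TwoBridgeLink r}

/-! ### The holonomy of lassos -/

section Lasso

variable {f : C((L.linkᶜ : Set S3), regularSet r)}

/-- The loop that runs along `β`, round `K` in the chart `e`, and back. -/
def lassoPath {b c : (L.linkᶜ : Set S3)} (e : StraighteningChart L.link)
    (hc : (c : S3) ∈ e.chart.source) (β : Path b c) : Path b b :=
  (β.trans (e.loop c hc)).trans β.symm

theorem exists_pathLifts_loop (f : C((L.linkᶜ : Set S3), regularSet r))
    {c : (L.linkᶜ : Set S3)} (e : StraighteningChart L.link) (hc : (c : S3) ∈ e.chart.source)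
    {z : FreeCover r} (hz : coverProj r z = f c) : ∃ k : DihedralGroup r.den,
      PathLifts (coverProj r) (fun t => f (e.loop c hc t)) z (k • z) :=
  PathLifts.exists_smul isQuotientCoveringMap_coverProj (by fun_prop)
    (by rw [(e.loop c hc).source, (e.loop c hc).target]) (by rw [(e.loop c hc).source, hz])

/-- The holonomy of a lasso is that of its noose, taken at the transported base point. -/
theorem holonomy_lasso {b c : (L.linkᶜ : Set S3)} {e : StraighteningChart L.link}
    {hc : (c : S3) ∈ e.chart.source} {β : Path b c} {z z' : FreeCover r}
    (hz : coverProj r z = f b) {k : DihedralGroup r.den}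
    (hβ : PathLifts (coverProj r) (fun t => f (β t)) z z')
    (h : PathLifts (coverProj r) (fun t => f (e.loop c hc t)) z' (k • z')) :
    holonomy isQuotientCoveringMap_coverProj f hz (lasso e hc β) = k⁻¹ :=
  holonomy_eq _ f hz (PathLifts.conj isQuotientCoveringMap_coverProj hβ h)

theorem exists_pathLifts_path (f : C((L.linkᶜ : Set S3), regularSet r))
    {b c : (L.linkᶜ : Set S3)} (β : Path b c) {z : FreeCover r} (hz : coverProj r z = f b) :
    ∃ z', PathLifts (coverProj r) (fun t => f (β t)) z z' :=
  PathLifts.exists isQuotientCoveringMap_coverProj.isCoveringMap (by fun_prop)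
    (by rw [β.source, hz])

theorem parity_holonomy
    (hf : ∀ (e : StraighteningChart L.link) {c : (L.linkᶜ : Set S3)}
      (hc : (c : S3) ∈ e.chart.source) {z : FreeCover r} {k : DihedralGroup r.den},
      PathLifts (coverProj r) (fun t => f (e.loop c hc t)) z (k • z) →
        parity k = Multiplicative.ofAdd 1)
    {b : (L.linkᶜ : Set S3)} {z : FreeCover r} (hz : coverProj r z = f b) (m : LinkGroup L.link b)
    (hm : IsMeridian m) :
    parity (holonomy isQuotientCoveringMap_coverProj f hz m) = Multiplicative.ofAdd 1 := by
  obtain ⟨c, e, hc, β, rfl⟩ := hm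
  obtain ⟨z', hz'⟩ := exists_pathLifts_path f β hz
  obtain ⟨k, hk⟩ := exists_pathLifts_loop f e hc (by rw [hz'.apply_right, β.target])
  rw [holonomy_lasso hz hz' hk, map_inv, hf e hc hk]
  decide

theorem PathLifts.of_lassoPath {b c : (L.linkᶜ : Set S3)} {e : StraighteningChart L.link}
    {hc : (c : S3) ∈ e.chart.source} {β : Path b c} {z : FreeCover r} {k : DihedralGroup r.den}
    (h : PathLifts (coverProj r) (fun t => f (lassoPath e hc β t)) z (k • z)) :
    ∃ z', PathLifts (coverProj r) (fun t => f (β t)) z z' ∧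
      PathLifts (coverProj r) (fun t => f (e.loop c hc t)) z' (k • z') := by
  have hπ := isQuotientCoveringMap_coverProj (r := r)
  obtain ⟨z', hz'⟩ := exists_pathLifts_path f β (z := z) (by
    rw [h.apply_left, (lassoPath e hc β).source])
  obtain ⟨k', hk'⟩ := exists_pathLifts_loop f e hc (by rw [hz'.apply_right, β.target])
  have := PathLifts.conj hπ hz' hk'
  rw [h.smul_unique hπ this]
  exact ⟨z', hz', hk'⟩

theorem holonomy_lasso_trans {b b' c : (L.linkᶜ : Set S3)} {e : StraighteningChart L.link}
    {hc : (c : S3) ∈ e.chart.source} {α : Path b b'} {β : Path b' c} {z z' : FreeCover r}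
    (hz : coverProj r z = f b) {k : DihedralGroup r.den}
    (hα : PathLifts (coverProj r) (fun t => f (α t)) z z')
    (h : PathLifts (coverProj r) (fun t => f (lassoPath e hc β t)) z' (k • z')) :
    holonomy isQuotientCoveringMap_coverProj f hz (lasso e hc (α.trans β)) = k⁻¹ := by
  obtain ⟨z'', hz'', hk⟩ := PathLifts.of_lassoPath h
  exact holonomy_lasso hz (hα.trans hz'') hk

end Lasso

/-! ### Neighbourhoods of the halves of the two tunnels -/

section Sector

variable (L) in
/-- The set of points of `S³` over the image in the dihedral quotient of a subset `V` of `ℂ²`. -/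
def imageNhd (V : Set (CoverPlane r)) : Set S3 :=
  {y | tangleToQuotient r (L.homeo.symm y) ∈
    Quotient.mk (MulAction.orbitRel (DihedralGroup r.den) (CoverPlane r)) '' V}

theorem isOpen_imageNhd {V : Set (CoverPlane r)} (hV : IsOpen V) : IsOpen (L.imageNhd V) :=
  (MulAction.isOpenQuotientMap_quotientMk.isOpenMap V hV).preimage
    (continuous_tangleToQuotient.comp L.homeo.symm.continuous)

theorem pt_mem_imageNhd {V : Set (CoverPlane r)} {x : (ℝ × ℝ) × I} (hx : toCover r x ∈ V) :
    L.pt x ∈ L.imageNhd V := by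
  refine ⟨_, hx, ?_⟩
  rw [pt, L.homeo.symm_apply_apply]
  rfl

/-- The points of `ℂ²` whose first coordinate has argument within `π/p` of `π j/p`. -/
def upperSector (r : ℚ) (j : ℤ) : Set (CoverPlane r) :=
  {w | w.1 * Complex.exp (-(Real.pi * Complex.I * j / r.den)) ∈ sector r.den}

/-- The points of `ℂ²` whose second coordinate has argument within `π/p` of `π j/p`. -/
def lowerSector (r : ℚ) (j : ℤ) : Set (CoverPlane r) :=
  {w | w.2 * Complex.exp (-(Real.pi * Complex.I * j / r.den)) ∈ sector r.den}

theorem isOpen_upperSector (j : ℤ) : IsOpen (upperSector r j) :=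
  isOpen_sector.preimage (continuous_fst.mul continuous_const : Continuous fun w : ℂ × ℂ =>
    w.1 * Complex.exp (-(Real.pi * Complex.I * j / r.den)))

theorem isOpen_lowerSector (j : ℤ) : IsOpen (lowerSector r j) :=
  isOpen_sector.preimage (continuous_snd.mul continuous_const : Continuous fun w : ℂ × ℂ =>
    w.2 * Complex.exp (-(Real.pi * Complex.I * j / r.den)))

theorem smul_mem_upperSector (j : ℤ) (g : DihedralGroup r.den) (w : CoverPlane r)
    (hw : w ∈ upperSector r j) :
    g • w ∈ upperSector r j ↔ g ∈ ({1, .sr (-(1 * j))} : Set (DihedralGroup r.den)) :=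
  planeAct_mem_sector (one_mul 1) j g hw

theorem smul_mem_lowerSector {v : ZMod r.den} (hv : -(r.num : ZMod r.den) * v = 1) (j : ℤ)
    (g : DihedralGroup r.den) (w : CoverPlane r) (hw : w ∈ lowerSector r j) :
    g • w ∈ lowerSector r j ↔ g ∈ ({1, .sr (-(v * j))} : Set (DihedralGroup r.den)) :=
  planeAct_mem_sector hv j g hw

theorem toCover_mem_upperSector (hn : 2 ≤ r.den) {x y : ℝ} {t : I} (ht : t ≠ 1) {j : ℤ}
    (h : |x - j| < 1) : toCover r ((x, y), t) ∈ upperSector r j := by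
  have ht' : 0 < 1 - (t : ℝ) := by
    have := lt_of_le_of_ne t.2.2 fun h => ht (Subtype.ext h)
    linarith
  have := mul_exp_mem_sector hn ht' h
  change ((1 - (t : ℝ) : ℝ) : ℂ) * Complex.exp (Real.pi * Complex.I * (x : ℝ) / r.den) *
    Complex.exp (-(Real.pi * Complex.I * j / r.den)) ∈ sector r.den
  convert this using 1
  rw [mul_assoc, ← Complex.exp_add]
  congr 2
  push_cast
  ring

theorem toCover_mem_lowerSector (hn : 2 ≤ r.den) {x y : ℝ} {t : I} (ht : t ≠ 0) {j : ℤ}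
    (h : |r.den * y - r.num * x - j| < 1) : toCover r ((x, y), t) ∈ lowerSector r j := by
  have ht' : 0 < (t : ℝ) := lt_of_le_of_ne t.2.1 fun h => ht (Subtype.ext h.symm)
  have := mul_exp_mem_sector hn ht' h
  change ((t : ℝ) : ℂ) * Complex.exp (Real.pi * Complex.I *
    ((r.den * y - r.num * x : ℝ) : ℂ) / r.den) *
    Complex.exp (-(Real.pi * Complex.I * j / r.den)) ∈ sector r.den
  convert this using 1
  rw [mul_assoc, ← Complex.exp_add]
  congr 2
  push_cast
  ring

/-- Let `V` be an open set preserved by one reflection and disjoint from all its translates other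
than by this reflection.  A loop in the image of `V` with odd holonomy, lifted from a point of `V`,
has this reflection as holonomy. -/
theorem eq_sr_of_forall_mem_imageNhd {V : Set (CoverPlane r)} (hV : IsOpen V) {i : ZMod r.den}
    (hVi : ∀ (g : DihedralGroup r.den), ∀ w ∈ V,
      g • w ∈ V ↔ g ∈ ({1, .sr i} : Set (DihedralGroup r.den)))
    {γ : I → (L.linkᶜ : Set S3)} (hγ : ∀ t, (γ t : S3) ∈ L.imageNhd V) {z : FreeCover r}
    (hz : (z : CoverPlane r) ∈ V) {k : DihedralGroup r.den}
    (hk : PathLifts (coverProj r) (fun t => L.complMap (γ t)) z (k • z))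
    (hpar : parity k = Multiplicative.ofAdd 1) : k = .sr i := by
  have hVi' : ∀ (g : DihedralGroup r.den), ∀ w ∈ (Subtype.val ⁻¹' V : Set (FreeCover r)),
      g • w ∈ (Subtype.val ⁻¹' V : Set (FreeCover r)) ↔
        g ∈ ({1, .sr i} : Set (DihedralGroup r.den)) := fun g w hw => hVi g w hw
  have := hk.mem_of_forall_mem_image isQuotientCoveringMap_coverProj
    (hV.preimage continuous_subtype_val) hVi' hz fun t => by
      obtain ⟨w, hw, hwt⟩ := hγ t
      exact ⟨⟨w, by rw [Set.mem_preimage, hwt]; exact (L.complMap (γ t)).2⟩, hw, Subtype.ext hwt⟩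
  rcases this with rfl | h
  · rw [map_one] at hpar
    exact absurd hpar (by decide)
  · exact h

/-- The product of the holonomies of two loops as in `eq_sr_of_forall_mem_imageNhd`, taken at any base
point of the covering: a change of base point conjugates it, which at most inverts the rotation. -/
theorem mul_eq_r_or {V₀ V₁ : Set (CoverPlane r)} (hV₀ : IsOpen V₀) (hV₁ : IsOpen V₁)
    {i₀ i₁ : ZMod r.den}
    (hi₀ : ∀ (g : DihedralGroup r.den), ∀ w ∈ V₀,
      g • w ∈ V₀ ↔ g ∈ ({1, .sr i₀} : Set (DihedralGroup r.den)))
    (hi₁ : ∀ (g : DihedralGroup r.den), ∀ w ∈ V₁,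
      g • w ∈ V₁ ↔ g ∈ ({1, .sr i₁} : Set (DihedralGroup r.den)))
    {γ₀ γ₁ : I → (L.linkᶜ : Set S3)} (hγ₀ : ∀ t, (γ₀ t : S3) ∈ L.imageNhd V₀)
    (hγ₁ : ∀ t, (γ₁ t : S3) ∈ L.imageNhd V₁) {x : (ℝ × ℝ) × I} (hx : L.pt x = γ₀ 0)
    (hx₀ : toCover r x ∈ V₀) (hx₁ : toCover r x ∈ V₁) {z : FreeCover r}
    {k₀ k₁ : DihedralGroup r.den}
    (hk₀ : PathLifts (coverProj r) (fun t => L.complMap (γ₀ t)) z (k₀ • z))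
    (hk₁ : PathLifts (coverProj r) (fun t => L.complMap (γ₁ t)) z (k₁ • z))
    (hp₀ : parity k₀ = Multiplicative.ofAdd 1) (hp₁ : parity k₁ = Multiplicative.ofAdd 1) :
    k₀ * k₁ = .r (i₁ - i₀) ∨ k₀ * k₁ = .r (-(i₁ - i₀)) := by
  have hπ := isQuotientCoveringMap_coverProj (r := r)
  have hxK : L.pt x ∈ (L.linkᶜ : Set S3) := hx ▸ (γ₀ 0).2
  obtain ⟨k, hk⟩ := hπ.apply_eq_iff_mem_orbit.mp (hk₀.apply_left.trans
    (show L.complMap (γ₀ 0) = coverProj r (L.liftPt x hxK) by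
      rw [coverProj_liftPt]
      exact congrArg L.complMap (Subtype.ext hx.symm)))
  replace hk : k • L.liftPt x hxK = z := hk
  have hmove : ∀ {γ : I → (L.linkᶜ : Set S3)} {l : DihedralGroup r.den},
      PathLifts (coverProj r) (fun t => L.complMap (γ t)) z (l • z) →
      PathLifts (coverProj r) (fun t => L.complMap (γ t)) (L.liftPt x hxK)
        ((k⁻¹ * l * k) • L.liftPt x hxK) := fun h => by
    have := h.smul hπ k⁻¹
    rwa [← hk, inv_smul_smul, ← mul_smul, ← mul_smul] at this
  have hpar : ∀ {l : DihedralGroup r.den}, parity l = Multiplicative.ofAdd 1 →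
      parity (k⁻¹ * l * k) = Multiplicative.ofAdd 1 := fun h => by
    rw [map_mul, map_mul, map_inv, mul_comm, mul_inv_cancel_left, h]
  have h₀ := eq_sr_of_forall_mem_imageNhd hV₀ hi₀ hγ₀ hx₀ (hmove hk₀) (hpar hp₀)
  have h₁ := eq_sr_of_forall_mem_imageNhd hV₁ hi₁ hγ₁ hx₁ (hmove hk₁) (hpar hp₁)
  have : k₀ * k₁ = k * .r (i₁ - i₀) * k⁻¹ := by
    rw [← DihedralGroup.sr_mul_sr, ← h₀, ← h₁]
    group
  rw [this]
  exact conj_r k _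

end Sector

/-! ### The link complement is path-connected -/

theorem pt_not_mem_link_half {v : ℝ × ℝ} {t : I} (h0 : t ≠ 0) (h1 : t ≠ 1)
    (h : ¬ ∃ a b : ℤ, v = ((a : ℝ), (b : ℝ))) : L.pt (v, t) ∈ (L.linkᶜ : Set S3) := fun h' =>
  h ((mk_mem_stringsUnion_iff h0 h1).mp (L.pt_mem_link_iff.mp h'))

/-- Two points of the link complement can be joined: move to height `1/2`, where the complement of the
lattice in the plane is path-connected. -/
theorem joined_compl (c c' : (L.linkᶜ : Set S3)) : Joined c c' := by
  obtain ⟨m, hm0, hm1⟩ : ∃ m : I, 0 < m ∧ m < 1 := exists_between zero_lt_one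
  -- vertical segments
  have hvert : ∀ (v : ℝ × ℝ) (t : I) (h : L.pt (v, t) ∈ (L.linkᶜ : Set S3)),
      ∃ h' : L.pt (v, m) ∈ (L.linkᶜ : Set S3),
        Joined (⟨L.pt (v, t), h⟩ : (L.linkᶜ : Set S3)) ⟨L.pt (v, m), h'⟩ := by
    intro v t h
    have hv : ¬ ∃ a b : ℤ, v = ((a : ℝ), (b : ℝ)) := by
      rintro ⟨a, b, rfl⟩
      exact h (L.pt_mem_link_iff.mpr (mk_mem_stringsUnion_of_int a b t))
    refine ⟨pt_not_mem_link_half hm0.ne' hm1.ne hv, ?_⟩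
    let s : I → I := fun u => ⟨(1 - u) * t + u * m, by
      constructor
      · have := u.2.1; have := u.2.2; have := t.2.1; have := m.2.1
        have : 0 ≤ 1 - (u : ℝ) := by linarith
        positivity
      · have := u.2.1; have := u.2.2; have := t.2.2; have := m.2.2
        nlinarith⟩
    have hs : Continuous s := by
      refine Continuous.subtype_mk ?_ _
      fun_prop
    refine ⟨⟨⟨fun u => ⟨L.pt (v, s u), ?_⟩, ?_⟩, ?_, ?_⟩⟩
    · by_cases hu : u = 0
      · have : s u = t := Subtype.ext (by simp [s, hu])
        rwa [this]
      · have hu' : 0 < (u : ℝ) := lt_of_le_of_ne u.2.1 fun h => hu (Subtype.ext h.symm)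
        have h1 : 0 < (m : ℝ) := hm0
        have h2 : (m : ℝ) < 1 := hm1
        have := u.2.2; have := t.2.1; have := t.2.2
        refine pt_not_mem_link_half (fun h => ?_) (fun h => ?_) hv
        · have := congrArg Subtype.val h
          change (1 - (u : ℝ)) * t + u * m = 0 at this
          nlinarith [mul_pos hu' h1, mul_nonneg (sub_nonneg.mpr u.2.2) t.2.1]
        · have := congrArg Subtype.val h
          change (1 - (u : ℝ)) * t + u * m = 1 at this
          nlinarith [mul_pos hu' (sub_pos.mpr h2),
            mul_nonneg (sub_nonneg.mpr u.2.2) (sub_nonneg.mpr t.2.2)]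
    · exact (L.continuous_pt.comp (continuous_const.prodMk hs)).subtype_mk _
    · exact Subtype.ext (congrArg (fun x => L.pt (v, x)) (Subtype.ext (by simp [s])))
    · exact Subtype.ext (congrArg (fun x => L.pt (v, x)) (Subtype.ext (by simp [s])))
  obtain ⟨_, hc⟩ := c
  obtain ⟨⟨v, t⟩, rfl⟩ := L.pt_surjective ‹_›
  obtain ⟨_, hc'⟩ := c'
  obtain ⟨⟨v', t'⟩, rfl⟩ := L.pt_surjective ‹_›
  obtain ⟨h, hj⟩ := hvert v t hc
  obtain ⟨h', hj'⟩ := hvert v' t' hc'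
  refine hj.trans (Joined.trans ?_ hj'.symm)
  have hcount : (Set.range fun x : ℤ × ℤ => (((x.1 : ℝ), (x.2 : ℝ)) : ℝ × ℝ)).Countable :=
    Set.countable_range _
  have hrank : 1 < Module.rank ℝ (ℝ × ℝ) := by
    rw [rank_prod', Module.rank_self, ← Nat.cast_one, ← Nat.cast_add, Nat.cast_lt]
    norm_num
  have hmem : ∀ w : ℝ × ℝ, L.pt (w, m) ∈ (L.linkᶜ : Set S3) ↔
      w ∈ (Set.range fun x : ℤ × ℤ => (((x.1 : ℝ), (x.2 : ℝ)) : ℝ × ℝ))ᶜ := by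
    intro w
    rw [Set.mem_compl_iff, Set.mem_compl_iff, pt_mem_link_iff,
      mk_mem_stringsUnion_iff hm0.ne' hm1.ne, not_iff_not]
    constructor
    · rintro ⟨a, b, rfl⟩
      exact ⟨(a, b), rfl⟩
    · rintro ⟨⟨a, b⟩, rfl⟩
      exact ⟨a, b, rfl⟩
  obtain ⟨γ, hγ⟩ := (hcount.isPathConnected_compl_of_one_lt_rank hrank).joinedIn v ((hmem v).mp h)
    v' ((hmem v').mp h')
  exact ⟨⟨⟨fun u => ⟨L.pt (γ u, m), (hmem _).mpr (hγ u)⟩,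
    (L.continuous_pt.comp (by fun_prop)).subtype_mk _⟩, Subtype.ext (by simp),
      Subtype.ext (by simp)⟩⟩

/-! ### Lassos along the upper tunnel, and the lower tunnel -/

theorem pt_mem_compl_of_fst {v : ℝ × ℝ} {t : I} (ht : t ≠ 1) (hv : ∀ a : ℤ, v.1 ≠ a) :
    L.pt (v, t) ∈ (L.linkᶜ : Set S3) := by
  intro h
  rw [pt_mem_link_iff] at h
  by_cases h0 : t = 0
  · subst h0
    obtain ⟨a, ha⟩ := mk_zero_mem_stringsUnion_iff.mp h
    exact hv a ha
  · obtain ⟨a, b, rfl⟩ := (mk_mem_stringsUnion_iff h0 ht).mp h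
    exact hv a rfl

theorem add_ne_intCast {a m : ℤ} {y : ℝ} (h0 : 0 < y) (h1 : y < 1) : (a : ℝ) + y ≠ m := by
  intro h
  have h2 : ((m - a : ℤ) : ℝ) = y := by push_cast; linarith
  rw [← h2] at h0 h1
  have h3 : 0 < m - a := by exact_mod_cast h0
  have h4 : m - a < 1 := by exact_mod_cast h1
  omega

/-- At a point close to a string there is a chart whose standard loop makes half a turn round a
lattice point of `ℝ²`. -/
theorem exists_chart_loop (a : ℤ) {δ : ℝ} (hδ0 : 0 < δ) (hδ1 : δ < 1) {t : I} (ht0 : 0 < t)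
    (ht1 : t < 1) {c : (L.linkᶜ : Set S3)} (hc : (c : S3) = L.pt ((a + δ, 0), t)) :
    ∃ (e : StraighteningChart L.link) (hce : (c : S3) ∈ e.chart.source), ∀ u : I,
      (e.loop c hce u : S3) =
        L.pt ((a + δ * Real.cos (Real.pi * (u : ℝ)), δ * Real.sin (Real.pi * (u : ℝ))), t) := by
  have hL : L.homeo '' stringsUnion r = L.link := rfl
  have hcK : TangleUnion.mk r ((a + δ, 0), t) ∈ ((stringsUnion r)ᶜ : Set (TangleUnion r)) :=
    fun h => c.2 (hc ▸ L.pt_mem_link_iff.mpr h)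
  obtain ⟨hc₁, hloop⟩ := stringChart_loop (r := r) (a := a) (b := 0) hδ0 hδ1 ht0 ht1
    ⟨_, hcK⟩ (by rw [Int.cast_zero])
  have hce : (c : S3) ∈ ((stringChart r a 0).map L.homeo hL).chart.source := by
    rw [StraighteningChart.mem_map_source, hc, pt, L.homeo.symm_apply_apply]
    exact hc₁
  refine ⟨_, hce, fun u => ?_⟩
  rw [StraighteningChart.map_loop _ _ hL hc₁ hce hc.symm, hloop u, Int.cast_zero, zero_add]
  rfl

/-- A path from the midpoint of the upper tunnel along one of its halves, rising slowly. -/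
theorem exists_tail (a : ℤ) {t₁ : I} (ht₁0 : 0 < t₁) (ht₁ : (t₁ : ℝ) < 1 / 2)
    {c c' : (L.linkᶜ : Set S3)} (hc : (c : S3) = L.pt ((a + 1 / 2, 0), 0))
    (hc' : (c' : S3) = L.pt ((a + t₁, 0), t₁)) :
    ∃ β : Path c c', ∀ u, ∃ (y : ℝ) (t : I), |y| ≤ 1 / 2 ∧ t ≤ t₁ ∧
      (β u : S3) = L.pt ((a + y, 0), t) := by
  have h0 : (0 : ℝ) < t₁ := ht₁0
  let y : I → ℝ := fun u => 1 / 2 + (u : ℝ) * (t₁ - 1 / 2)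
  have hy : ∀ u : I, (t₁ : ℝ) ≤ y u ∧ y u ≤ 1 / 2 := fun u => by
    have h1 := mul_nonneg u.2.1 (sub_nonneg.mpr ht₁.le)
    have h2 := mul_nonneg (sub_nonneg.mpr u.2.2) (sub_nonneg.mpr ht₁.le)
    constructor <;> simp only [y] <;> linarith
  have hut : ∀ u : I, u * t₁ ≤ t₁ := fun u => unitInterval.mul_le_right
  have ht₁1 : t₁ < 1 := show (t₁ : ℝ) < 1 by linarith
  have hcont : Continuous fun u : I => (((a + y u, 0), u * t₁) : (ℝ × ℝ) × I) := by fun_prop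
  refine ⟨⟨⟨fun u => ⟨L.pt ((a + y u, 0), u * t₁), pt_mem_compl_of_fst
      ((hut u).trans_lt ht₁1).ne fun m => add_ne_intCast (h0.trans_le (hy u).1)
        ((hy u).2.trans_lt (by norm_num))⟩, (L.continuous_pt.comp hcont).subtype_mk _⟩, ?_, ?_⟩,
    fun u => ⟨y u, u * t₁, ?_, hut u, rfl⟩⟩
  · exact Subtype.ext (by simp [hc, y])
  · exact Subtype.ext (by simp [hc', y])
  · rw [abs_of_nonneg (h0.le.trans (hy u).1)]
    exact (hy u).2

/-- From the midpoint of the upper tunnel one can follow either half of the tunnel to the string at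
its end and go round that string, all inside a given neighbourhood of the half tunnel. -/
theorem exists_lassoPath_mem (a : ℤ) {O : Set S3} (hO : IsOpen O)
    (hOmem : ∀ y : ℝ, |y| ≤ 1 / 2 → L.pt ((a + y, 0), 0) ∈ O) {c : (L.linkᶜ : Set S3)}
    (hc : (c : S3) = L.pt ((a + 1 / 2, 0), 0)) :
    ∃ (c' : (L.linkᶜ : Set S3)) (e : StraighteningChart L.link) (hc' : (c' : S3) ∈ e.chart.source)
      (β : Path c c'), ∀ t, (lassoPath e hc' β t : S3) ∈ O := by
  -- a neighbourhood of the half tunnel in the coordinates `ℝ² × [0, 1]`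
  let C : Set ((ℝ × ℝ) × I) := (fun y : ℝ => ((a + y, 0), 0)) '' Set.Icc (-(1 / 2)) (1 / 2)
  have hC : IsCompact C := isCompact_Icc.image (by fun_prop)
  obtain ⟨ε, hε, hsub⟩ := hC.exists_thickening_subset_open (hO.preimage L.continuous_pt) (by
    rintro _ ⟨y, hy, rfl⟩
    exact hOmem y (abs_le.mpr hy))
  obtain ⟨δ, hδ0, hδε, hδ1⟩ : ∃ δ : ℝ, 0 < δ ∧ δ < ε ∧ δ < 1 / 2 :=
    ⟨min ε (1 / 2) / 2, by positivity,
      by linarith [min_le_left ε (1 / 2), lt_min hε (one_half_pos (α := ℝ))],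
      by linarith [min_le_right ε (1 / 2), lt_min hε (one_half_pos (α := ℝ))]⟩
  have hmem : ∀ {y y' : ℝ} {t : I}, |y| ≤ 1 / 2 → |y'| < ε → (t : ℝ) < ε →
      L.pt ((a + y, y'), t) ∈ O := by
    intro y y' t hy hy' ht
    refine hsub (Metric.mem_thickening_iff.mpr ⟨_, ⟨y, abs_le.mp hy, rfl⟩, ?_⟩)
    simp only [Prod.dist_eq, dist_self, max_lt_iff, Real.dist_eq, sub_zero]
    refine ⟨⟨hε, hy'⟩, ?_⟩
    rw [Subtype.dist_eq, Real.dist_eq]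
    simpa [abs_of_nonneg t.2.1] using ht
  let t₁ : I := ⟨δ, hδ0.le, by linarith⟩
  have ht₁0 : 0 < t₁ := hδ0
  have ht₁1 : t₁ < 1 := show δ < 1 by linarith
  have hcK : L.pt ((a + δ, 0), t₁) ∈ (L.linkᶜ : Set S3) :=
    pt_mem_compl_of_fst ht₁1.ne fun m => add_ne_intCast hδ0 (by linarith)
  obtain ⟨e, hc', hloop⟩ := exists_chart_loop a hδ0 (by linarith) ht₁0 ht₁1 (c := ⟨_, hcK⟩) rfl
  obtain ⟨β, hβ⟩ := exists_tail a ht₁0 hδ1 hc (c' := ⟨_, hcK⟩) rfl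
  have hβO : ∀ u, (β u : S3) ∈ O := fun u => by
    obtain ⟨y, t, hy, ht, h⟩ := hβ u
    rw [h]
    exact hmem hy (by simpa using hε) ((show (t : ℝ) ≤ δ from ht).trans_lt hδε)
  have hloopO : ∀ u, (e.loop _ hc' u : S3) ∈ O := fun u => by
    rw [hloop u]
    refine hmem ?_ ?_ hδε
    · rw [abs_mul, abs_of_pos hδ0]
      exact (mul_le_of_le_one_right hδ0.le (Real.abs_cos_le_one _)).trans hδ1.le
    · rw [abs_mul, abs_of_pos hδ0]
      exact (mul_le_of_le_one_right hδ0.le (Real.abs_sin_le_one _)).trans_lt hδε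
  exact ⟨_, e, hc', β, Path.trans_apply_mem (S := Subtype.val ⁻¹' O)
    (Path.trans_apply_mem hβO hloopO) fun u => hβO _⟩

/-- The lower tunnel is parametrised by the coordinate transverse to the lines of slope `r`, up to
sign and translation by even integers. -/
theorem pt_one_eq {v w : ℝ × ℝ} {m : ℤ}
    (h : r.den * w.2 - r.num * w.1 = r.den * v.2 - r.num * v.1 + 2 * m ∨
      r.den * w.2 - r.num * w.1 = 2 * m - (r.den * v.2 - r.num * v.1)) :
    L.pt (v, 1) = L.pt (w, 1) := by
  have hcop : IsCoprime (r.den : ℤ) r.num := by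
    rw [Int.isCoprime_iff_gcd_eq_one, Int.gcd_comm]
    exact r.reduced
  obtain ⟨x, y, hxy⟩ := hcop
  have hp : (r.den : ℝ) ≠ 0 := by exact_mod_cast r.den_nz
  have hxy' : (x * r.den + y * r.num : ℝ) = 1 := by exact_mod_cast hxy
  refine L.pt_eq_iff.mpr ⟨rfl, Or.inr (Or.inr ⟨rfl, ?_⟩)⟩
  rcases h with h | h
  · refine ⟨(w.1 + 2 * m * y - v.1) / r.den, -m * y, m * x, Or.inl (Prod.ext ?_ ?_)⟩
    · simp only [dirSlope]
      push_cast
      field_simp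
      ring
    · simp only [dirSlope]
      push_cast
      field_simp
      linear_combination h - 2 * m * hxy'
  · refine ⟨(-w.1 - 2 * m * y - v.1) / r.den, -m * y, m * x, Or.inr (Prod.ext ?_ ?_)⟩
    · simp only [dirSlope]
      push_cast
      field_simp
      ring
    · simp only [dirSlope]
      push_cast
      field_simp
      linear_combination h - 2 * m * hxy'

theorem exists_of_mem_lowerTunnel {x : S3} (hx : x ∈ L.lowerTunnel) :
    ∃ s ∈ Set.Icc (0 : ℝ) 1, x = L.pt ((0, s / r.den), 1) := by
  obtain ⟨_, ⟨v, rfl⟩, rfl⟩ := hx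
  have hp : (r.den : ℝ) ≠ 0 := by exact_mod_cast r.den_nz
  set s := r.den * v.2 - r.num * v.1 with hs
  have hround := abs_sub_round (s / 2)
  have habs : |s - 2 * round (s / 2)| ≤ 1 := by
    have : s - 2 * round (s / 2) = 2 * (s / 2 - round (s / 2)) := by ring
    rw [this, abs_mul, abs_two]
    linarith
  refine ⟨_, ⟨abs_nonneg _, habs⟩, ?_⟩
  rcases abs_choice (s - 2 * round (s / 2)) with h | h <;> rw [h]
  · refine pt_one_eq (m := -round (s / 2)) (Or.inl ?_)
    simp only [mul_div_cancel₀ _ hp]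
    rw [← hs]
    push_cast
    ring
  · refine pt_one_eq (m := round (s / 2)) (Or.inr ?_)
    simp only [mul_div_cancel₀ _ hp]
    rw [← hs]
    ring

/-- A homeomorphism of the pair that carries the upper to the lower tunnel carries the two halves of
the upper to the two halves of the lower tunnel. -/
theorem exists_lower_coordinate {g : S3 ≃ₜ S3} (hK : g '' L.link = L.link)
    (hg : g '' L.upperTunnel = L.lowerTunnel) :
    ∃ (j : ℤ) (S : ℝ → ℝ), (j = 0 ∨ j = 1) ∧
      (∀ x, g (L.pt ((x, 0), 0)) = L.pt ((0, S x / r.den), 1)) ∧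
      (∀ x ∈ Set.Ico (0 : ℝ) 1, |S x - j| < 1) ∧
      ∀ x ∈ Set.Ioc (0 : ℝ) 1, |S x - (1 - j : ℤ)| < 1 := by
  have hp : (r.den : ℝ) ≠ 0 := by exact_mod_cast r.den_nz
  have hex : ∀ x : ℝ, ∃ s ∈ Set.Icc (0 : ℝ) 1, g (L.pt ((x, 0), 0)) = L.pt ((0, s / r.den), 1) :=
    fun x => exists_of_mem_lowerTunnel (hg ▸ Set.mem_image_of_mem g ⟨_, ⟨(x, 0), rfl⟩, rfl⟩)
  choose S hS hgS using hex
  have hint : ∀ x : ℝ, (∃ m : ℤ, S x = m) ↔ ∃ a : ℤ, x = a := fun x => by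
    have h1 := L.pt_mem_link_iff (x := ((0, S x / r.den), 1))
    have h2 := L.pt_mem_link_iff (x := ((x, 0), 0))
    rw [mk_one_mem_stringsUnion_iff] at h1
    rw [mk_zero_mem_stringsUnion_iff] at h2
    rw [← hgS, mem_link_of_image_eq hK, h2] at h1
    simpa [mul_div_cancel₀ _ hp] using h1.symm
  have hend : ∀ x : ℝ, (∃ a : ℤ, x = a) → S x = 0 ∨ S x = 1 := fun x hx => by
    obtain ⟨m, hm⟩ := (hint x).mpr hx
    obtain ⟨h0, h1⟩ := hS x
    rw [hm] at h0 h1 ⊢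
    have h0' : 0 ≤ m := by exact_mod_cast h0
    have h1' : m ≤ 1 := by exact_mod_cast h1
    obtain rfl | rfl : m = 0 ∨ m = 1 := by omega
    · simp
    · simp
  have hne : S 0 ≠ S 1 := fun h => by
    have h1 := g.injective ((hgS 0).trans ((congrArg (fun s => L.pt ((0, s / r.den), 1)) h).trans
      (hgS 1).symm))
    have key : ∀ {v : ℝ × ℝ}, v.1 = 0 → ¬ PillowRel v (1, 0) := by
      rintro v hv ⟨a, b, h | h⟩
      · have h := congrArg Prod.fst h
        simp only [hv, zero_add] at h
        have : 1 = 2 * a := by exact_mod_cast h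
        omega
      · have h := congrArg Prod.fst h
        simp only [hv, sub_zero] at h
        have : 1 = 2 * a := by exact_mod_cast h
        omega
    obtain ⟨-, h | ⟨-, c, h⟩ | ⟨h, -⟩⟩ := L.pt_eq_iff.mp h1
    · exact key rfl h
    · exact key (by simp [dirInfty]) h
    · exact zero_ne_one h
  have hinner : ∀ x ∈ Set.Ioo (0 : ℝ) 1, 0 < S x ∧ S x < 1 := fun x hx => by
    have hx' : ¬ ∃ a : ℤ, x = a := by
      rintro ⟨a, ha⟩
      exact add_ne_intCast (a := 0) (m := a) hx.1 hx.2 (by rw [Int.cast_zero, zero_add, ha])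
    rw [← hint] at hx'
    refine ⟨lt_of_le_of_ne (hS x).1 fun h => hx' ⟨0, by simp [← h]⟩,
      lt_of_le_of_ne (hS x).2 fun h => hx' ⟨1, by simp [h]⟩⟩
  have h0 := hend 0 ⟨0, by simp⟩
  have h1 := hend 1 ⟨1, by simp⟩
  obtain ⟨j, hj, hj0, hj1⟩ : ∃ j : ℤ, (j = 0 ∨ j = 1) ∧ S 0 = j ∧ S 1 = (1 - j : ℤ) := by
    rcases h0 with h0 | h0
    · refine ⟨0, Or.inl rfl, by simp [h0], ?_⟩
      rcases h1 with h1 | h1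
      · exact absurd (h0.trans h1.symm) hne
      · simp [h1]
    · refine ⟨1, Or.inr rfl, by simp [h0], ?_⟩
      rcases h1 with h1 | h1
      · simp [h1]
      · exact absurd (h0.trans h1.symm) hne
  have hinner' : ∀ x ∈ Set.Ioo (0 : ℝ) 1, |S x - j| < 1 ∧ |S x - (1 - j : ℤ)| < 1 := fun x hx => by
    obtain ⟨h2, h3⟩ := hinner x hx
    rcases hj with rfl | rfl <;> push_cast <;> constructor <;> rw [abs_lt] <;> constructor <;>
      linarith
  refine ⟨j, S, hj, hgS, fun x hx => ?_, fun x hx => ?_⟩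
  · rcases hx.1.eq_or_lt with rfl | h
    · simp [hj0]
    · exact (hinner' x ⟨h, hx.2⟩).1
  · rcases hx.2.eq_or_lt with rfl | h
    · simp [hj1]
    · exact (hinner' x ⟨hx.1, h⟩).2

/-! ### Comparison of the holonomies before and after the inversion -/

/-- If a tunnel is fixed pointwise by a homeomorphism `h` of the pair, pulling back the dihedral
covering by `h` does not change the holonomy of the meridian pair determined by the tunnel, for a
suitable base point. -/
theorem exists_holonomy_eq_of_represents {h : S3 ≃ₜ S3} (hK : h '' L.link = L.link)
    {τ : Tunnel L.link} (hτ : Set.range τ.arc ⊆ Function.fixedPoints h)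
    {b : (L.linkᶜ : Set S3)} {m₁ m₂ : LinkGroup L.link b} (hm : τ.Represents m₁ m₂)
    {z : FreeCover r} (hz : coverProj r z = L.complMap b) :
    ∃ (z' : FreeCover r) (hz' : coverProj r z' = (L.complMap.comp (complHomeo h hK)) b),
      holonomy isQuotientCoveringMap_coverProj L.complMap hz (m₁ * m₂) =
        holonomy isQuotientCoveringMap_coverProj (L.complMap.comp (complHomeo h hK)) hz'
          (m₁ * m₂) := by
  have hfix : ∀ t, h (τ.arc t) = τ.arc t := fun t => hτ ⟨t, rfl⟩
  obtain ⟨s, s', hs, e, e', he, he', β, rfl, rfl⟩ := hm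
  have hfixC : ∀ x : (L.linkᶜ : Set S3), h x = x → complHomeo h hK x = x :=
    fun x hx => Subtype.ext hx
  have hsK : ∀ x : Set.Ioo (0 : I) 1, complHomeo h hK (τ.point x) = τ.point x :=
    fun x => hfixC _ (hfix _)
  -- the lift of `β`, and the lift of its image under `h` with the same end
  obtain ⟨z₁, hβ⟩ := exists_pathLifts_path L.complMap β hz
  have hz₁ : coverProj r z₁ = L.complMap (τ.point s) := by rw [hβ.apply_right, β.target]
  have hz₁' : coverProj r z₁ = (L.complMap.comp (complHomeo h hK)) (τ.point s) := by
    rw [hz₁, ContinuousMap.comp_apply, hsK]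
  obtain ⟨z', hβ'⟩ := exists_pathLifts_path (L.complMap.comp (complHomeo h hK)) β.symm hz₁'
  have hz' : coverProj r z' = (L.complMap.comp (complHomeo h hK)) b := by
    rw [hβ'.apply_right, β.symm.target]
  replace hβ' := hβ'.symm
  rw [Path.symm_symm] at hβ'
  -- the segment of the tunnel is fixed
  obtain ⟨z₂, hσ⟩ := exists_pathLifts_path L.complMap (τ.segment s s' hs) hz₁
  have hz₂ : coverProj r z₂ = L.complMap (τ.point s') := by
    rw [hσ.apply_right, (τ.segment s s' hs).target]
  have hσ' : PathLifts (coverProj r) (fun t => (L.complMap.comp (complHomeo h hK))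
      (τ.segment s s' hs t)) z₁ z₂ := by
    convert hσ using 2 with t
    rw [ContinuousMap.comp_apply, hfixC]
    exact hfix _
  -- the two nooses
  obtain ⟨k₁, hk₁⟩ := exists_pathLifts_loop L.complMap e (he _ le_rfl) hz₁
  obtain ⟨k₁', hk₁'⟩ := exists_pathLifts_loop (L.complMap.comp (complHomeo h hK)) e (he _ le_rfl)
    hz₁'
  obtain ⟨k₂, hk₂⟩ := exists_pathLifts_loop L.complMap e' (he' _ le_rfl) hz₂
  obtain ⟨k₂', hk₂'⟩ := exists_pathLifts_loop (L.complMap.comp (complHomeo h hK)) e'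
    (he' _ le_rfl) (by rw [hz₂, ContinuousMap.comp_apply, hsK])
  have hs0 : (s : I) ≠ 0 := s.2.1.ne'
  have hs1 : (s : I) < 1 := s.2.2
  obtain rfl : k₁ = k₁' := by
    have hle : ∀ t : I, t * (s : I) ≤ s := fun t => unitInterval.mul_le_right
    refine holonomy_eq_of_fixed_arc h hK e (α := fun t => τ.arc (t * (s : I)))
      (by fun_prop) ?_ ?_ (fun t => he _ (hle t)) (fun t => hfix _) ?_ _ hk₁ hk₁'
    · exact (τ.mem_iff _).mpr (Or.inl (zero_mul _))
    · intro t ht hmem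
      rcases (τ.mem_iff _).mp hmem with h0 | h1
      · exact (mul_ne_zero ht hs0) h0
      · exact ((hle t).trans_lt hs1).ne h1
    · rw [one_mul]
      rfl
  obtain rfl : k₂ = k₂' := by
    have hle : ∀ t : I, (s' : I) ≤ σ (t * σ (s' : I)) := fun t => by
      rw [unitInterval.le_symm_comm]
      exact unitInterval.mul_le_right
    refine holonomy_eq_of_fixed_arc h hK e' (α := fun t => τ.arc (σ (t * σ (s' : I))))
      (by fun_prop) ?_ ?_ (fun t => he' _ (hle t)) (fun t => hfix _) ?_ _ hk₂ hk₂'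
    · exact (τ.mem_iff _).mpr (Or.inr (by simp))
    · intro t ht hmem
      rcases (τ.mem_iff _).mp hmem with h0 | h1
      · exact (s'.2.1.trans_le (hle t)).ne' h0
      · rw [unitInterval.symm_eq_one] at h1
        refine mul_ne_zero ht ?_ h1
        rw [Ne, unitInterval.symm_eq_zero]
        exact s'.2.2.ne
    · rw [one_mul, unitInterval.symm_symm]
      rfl
  refine ⟨z', hz', ?_⟩
  rw [map_mul, map_mul, holonomy_lasso hz hβ hk₁, holonomy_lasso hz' hβ' hk₁',
    holonomy_lasso hz (hβ.trans hσ) hk₂, holonomy_lasso hz' (hβ'.trans hσ') hk₂']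

/-- The holonomy of a loop moved by an isotopy of the pair. -/
theorem exists_pathLifts_of_isotopic {h g : S3 ≃ₜ S3} (hK : h '' L.link = L.link)
    (hgK : g '' L.link = L.link) (hiso : PairwiseIsotopic L.link h g) (c : (L.linkᶜ : Set S3))
    {z : FreeCover r} (hz : coverProj r z = L.complMap (complHomeo h hK c)) :
    ∃ z', ∀ (γ : Path c c) (k : DihedralGroup r.den),
      PathLifts (coverProj r) (fun t => L.complMap (complHomeo h hK (γ t))) z (k • z) →
      PathLifts (coverProj r) (fun t => L.complMap (complHomeo g hgK (γ t))) z' (k • z') := by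
  have hπ := isQuotientCoveringMap_coverProj (r := r)
  obtain ⟨F, hF, rfl, rfl, hFK⟩ := hiso
  have hmem : ∀ (s : I) (y : (L.linkᶜ : Set S3)), F s y ∈ (L.linkᶜ : Set S3) :=
    fun s y k => y.2 ((mem_link_of_image_eq (hFK s)).mp k)
  let F' : C(I × (L.linkᶜ : Set S3), regularSet r) :=
    L.complMap.comp ⟨fun x => ⟨F x.1 x.2, hmem _ _⟩,
      (hF.comp (by fun_prop : Continuous fun x : I × (L.linkᶜ : Set S3) =>
        ((x.1, (x.2 : S3)) : I × S3))).subtype_mk _⟩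
  obtain ⟨z', hz'⟩ := PathLifts.exists hπ.isCoveringMap (γ := fun s => F' (s, c)) (by fun_prop) hz
  refine ⟨z', fun γ k hk => ?_⟩
  exact PathLifts.of_homotopy hπ (F'.comp ⟨fun x => (x.1, γ x.2), by fun_prop⟩)
    (fun s => by simp) (by simpa using hz') hk

/-- The two lassos along the halves of the upper tunnel, chosen so that they stay close to the
upper tunnel and their images under `g` stay close to the lower tunnel. -/
theorem exists_lassos {g : S3 ≃ₜ S3} (hn : 2 ≤ r.den) (hK : g '' L.link = L.link)
    (hg : g '' L.upperTunnel = L.lowerTunnel) {c : (L.linkᶜ : Set S3)}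
    (hc : (c : S3) = L.pt ((1 / 2, 0), 0)) :
    ∃ (j : ℤ) (y : ℝ), (j = 0 ∨ j = 1) ∧ g c = L.pt ((0, y), 1) ∧
      toCover r ((0, y), 1) ∈ lowerSector r j ∧ toCover r ((0, y), 1) ∈ lowerSector r (1 - j) ∧
      (∃ (c' : (L.linkᶜ : Set S3)) (e : StraighteningChart L.link)
        (hc' : (c' : S3) ∈ e.chart.source) (β : Path c c'), ∀ t,
          (lassoPath e hc' β t : S3) ∈ L.imageNhd (upperSector r 0) ∧
          g (lassoPath e hc' β t) ∈ L.imageNhd (lowerSector r j)) ∧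
      ∃ (c' : (L.linkᶜ : Set S3)) (e : StraighteningChart L.link)
        (hc' : (c' : S3) ∈ e.chart.source) (β : Path c c'), ∀ t,
          (lassoPath e hc' β t : S3) ∈ L.imageNhd (upperSector r 1) ∧
          g (lassoPath e hc' β t) ∈ L.imageNhd (lowerSector r (1 - j)) := by
  obtain ⟨j, S, hj, hgS, h0, h1⟩ := exists_lower_coordinate hK hg
  have hp : (r.den : ℝ) ≠ 0 := by exact_mod_cast r.den_nz
  have hlow : ∀ {x : ℝ} {i : ℤ}, |S x - i| < 1 →
      toCover r ((0, S x / r.den), 1) ∈ lowerSector r i := fun {x i} h =>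
    toCover_mem_lowerSector hn one_ne_zero (by rwa [mul_div_cancel₀ _ hp, mul_zero, sub_zero])
  have hopen : ∀ i i' : ℤ,
      IsOpen (L.imageNhd (upperSector r i) ∩ g ⁻¹' L.imageNhd (lowerSector r i')) := fun i i' =>
    (isOpen_imageNhd (isOpen_upperSector i)).inter
      ((isOpen_imageNhd (isOpen_lowerSector i')).preimage g.continuous)
  refine ⟨j, S (1 / 2) / r.den, hj, by rw [hc, hgS], hlow (h0 _ (by norm_num)),
    hlow (h1 _ (by norm_num)), exists_lassoPath_mem 0 (hopen 0 j) (fun y hy => ⟨?_, ?_⟩) ?_,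
    exists_lassoPath_mem 1 (hopen 1 (1 - j)) (fun y hy => ⟨?_, ?_⟩) ?_⟩
  · refine pt_mem_imageNhd (toCover_mem_upperSector hn zero_ne_one ?_)
    rw [add_sub_cancel_left]
    linarith
  · have : L.pt ((((0 : ℤ) : ℝ) + y, 0), 0) = L.pt ((|y|, 0), 0) := by
      refine L.pt_eq_iff.mpr ⟨rfl, Or.inl ⟨0, 0, ?_⟩⟩
      rcases abs_choice y with h | h <;> simp [h]
    rw [Set.mem_preimage, this, hgS]
    exact pt_mem_imageNhd (hlow (h0 _ ⟨abs_nonneg y, by linarith⟩))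
  · rw [hc, Int.cast_zero, zero_add]
  · refine pt_mem_imageNhd (toCover_mem_upperSector hn zero_ne_one ?_)
    rw [add_sub_cancel_left]
    linarith
  · have : L.pt ((((1 : ℤ) : ℝ) + y, 0), 0) = L.pt ((1 - |y|, 0), 0) := by
      refine L.pt_eq_iff.mpr ⟨rfl, Or.inl ?_⟩
      rcases abs_choice y with h | h
      · refine ⟨1, 0, Or.inr ?_⟩
        rw [h]
        ext <;> push_cast <;> ring
      · refine ⟨0, 0, Or.inl ?_⟩
        rw [h]
        ext <;> push_cast <;> ring
    rw [Set.mem_preimage, this, hgS]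
    exact pt_mem_imageNhd (hlow (h1 _ ⟨by linarith, by linarith [abs_nonneg y]⟩))
  · -- the rotation about `(1, 0)` exchanges `(1/2, 0)` and `(3/2, 0)`
    rw [hc]
    refine L.pt_eq_iff.mpr ⟨rfl, Or.inl ⟨1, 0, Or.inr ?_⟩⟩
    ext <;> push_cast <;> ring

end TwoBridgeLink

/-- The congruence that results from comparing rotations by `±1` with rotations by `±v`, where `v` is
inverse to `-q`. -/
theorem num_modEq_of_mul_eq_one {r : ℚ} {v : ZMod r.den} (hv : -(r.num : ZMod r.den) * v = 1)
    (h : v = 1 ∨ v = -1) : r.num ≡ 1 [ZMOD (r.den : ℤ)] ∨ r.num ≡ -1 [ZMOD (r.den : ℤ)] := by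
  rw [← ZMod.intCast_eq_intCast_iff, ← ZMod.intCast_eq_intCast_iff]
  push_cast
  rcases h with rfl | rfl
  · right
    rw [← hv]
    ring
  · left
    rw [← hv]
    ring

end TwoBridge

end

open TwoBridge TwoBridgeLink

theorem proposition6p1 (r : ℚ) (hr : TwoBridge.IsHyperbolicSlope r)
    (L : TwoBridge.TwoBridgeLink r) (b : ((L.link)ᶜ : Set TwoBridge.S3))
    (m₁ m₂ : TwoBridge.LinkGroup L.link b) (hm : L.IsExtraMeridianPair m₁ m₂) :
    ¬ ∀ x : TwoBridge.H1DoubleCover L.link b,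
      x ∈ Subgroup.zpowers (TwoBridge.omega hm.isMeridian.1 hm.isMeridian.2) := by
  intro hgen
  have hn : 2 ≤ r.den := by
    by_contra hlt
    have h1 : r.den = 1 := by have := r.den_pos; omega
    refine hr.1 ?_
    rw [h1, Nat.cast_one]
    exact Int.modEq_one
  have hmer := hm.isMeridian
  obtain ⟨h, ⟨hinv, g, hiso, hg, -⟩, τ, hτ, hrep⟩ := id hm
  have hK := hinv.preserves
  have hgK : g '' L.link = L.link := by
    obtain ⟨F, -, -, rfl, hF⟩ := hiso
    exact hF 1
  have hπ := isQuotientCoveringMap_coverProj (r := r)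
  -- the two dihedral representations agree on all products of two meridians
  obtain ⟨z, hz⟩ := hπ.surjective (L.complMap b)
  obtain ⟨z', hz', hzz'⟩ := exists_holonomy_eq_of_represents hK hτ hrep hz
  have hpar := parity_holonomy (f := L.complMap) (fun e _ hc _ _ => parity_loop e hc) hz
  have hpar' := parity_holonomy (f := L.complMap.comp (complHomeo h hK))
    (fun e _ hc _ _ => parity_complHomeo_loop h hK e hc) hz'
  have hagree := fun m m' => eq_of_forall_mem_zpowers_omega (m := m) (m' := m') hmer.1 hmer.2
    hpar hpar' hzz' hgen
  -- the meridian pair of the upper tunnel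
  obtain ⟨c, hc⟩ : ∃ c : (L.linkᶜ : Set S3), (c : S3) = L.pt ((1 / 2, 0), 0) :=
    ⟨⟨_, pt_mem_compl_of_fst zero_ne_one fun a => by
      have := add_ne_intCast (a := 0) (m := a) (y := 1 / 2) (by norm_num) (by norm_num)
      rwa [Int.cast_zero, zero_add] at this⟩, rfl⟩
  obtain ⟨j, y, hj, hgc, hyj, hyj', ⟨c₀, e₀, hc₀, β₀, hγ₀⟩, ⟨c₁, e₁, hc₁, β₁, hγ₁⟩⟩ :=
    exists_lassos hn hgK hg hc
  obtain ⟨α⟩ := joined_compl b c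
  obtain ⟨w, hw⟩ := exists_pathLifts_path L.complMap α hz
  obtain ⟨w', hw'⟩ := exists_pathLifts_path (L.complMap.comp (complHomeo h hK)) α hz'
  have hwc : coverProj r w = L.complMap c := by rw [hw.apply_right, α.target]
  have hwc' : coverProj r w' = (L.complMap.comp (complHomeo h hK)) c := by
    rw [hw'.apply_right, α.target]
  have hloop : ∀ (f : C((L.linkᶜ : Set S3), regularSet r)) {u : FreeCover r} (γ : Path c c),
      coverProj r u = f c → ∃ k : DihedralGroup r.den,
        PathLifts (coverProj r) (fun t => f (γ t)) u (k • u) := fun f u γ hu =>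
    PathLifts.exists_smul hπ (by fun_prop) (by rw [γ.source, γ.target]) (by rw [hu, γ.source])
  obtain ⟨k₀, hk₀⟩ := hloop L.complMap (lassoPath e₀ hc₀ β₀) hwc
  obtain ⟨k₁, hk₁⟩ := hloop L.complMap (lassoPath e₁ hc₁ β₁) hwc
  obtain ⟨k₀', hk₀'⟩ := hloop (L.complMap.comp (complHomeo h hK)) (lassoPath e₀ hc₀ β₀) hwc'
  obtain ⟨k₁', hk₁'⟩ := hloop (L.complMap.comp (complHomeo h hK)) (lassoPath e₁ hc₁ β₁) hwc'
  have hM₀ : IsMeridian (lasso e₀ hc₀ (α.trans β₀)) := ⟨_, _, _, _, rfl⟩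
  have hM₁ : IsMeridian (lasso e₁ hc₁ (α.trans β₁)) := ⟨_, _, _, _, rfl⟩
  have q₀ := holonomy_lasso_trans hz hw hk₀
  have q₁ := holonomy_lasso_trans hz hw hk₁
  have q₀' := holonomy_lasso_trans hz' hw' hk₀'
  have q₁' := holonomy_lasso_trans hz' hw' hk₁'
  have hprod := hagree _ _ hM₁ hM₀
  rw [map_mul, map_mul, q₀, q₁, q₀', q₁', ← mul_inv_rev, ← mul_inv_rev, inv_inj] at hprod
  have hinvpar : ∀ {k : DihedralGroup r.den}, parity k⁻¹ = Multiplicative.ofAdd 1 →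
      parity k = Multiplicative.ofAdd 1 := fun hk => by
    rw [← inv_inv (parity _), ← map_inv, hk]
    decide
  -- near the upper tunnel the product is a rotation by `±1`
  have hup := mul_eq_r_or (isOpen_upperSector 0) (isOpen_upperSector 1) (smul_mem_upperSector 0)
    (smul_mem_upperSector 1) (fun t => (hγ₀ t).1) (fun t => (hγ₁ t).1)
    (x := ((1 / 2, 0), 0)) (by rw [(lassoPath e₀ hc₀ β₀).source, hc])
    (toCover_mem_upperSector hn zero_ne_one (by norm_num [abs_lt]))
    (toCover_mem_upperSector hn zero_ne_one (by norm_num [abs_lt])) hk₀ hk₁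
    (hinvpar (q₀ ▸ hpar _ hM₀)) (hinvpar (q₁ ▸ hpar _ hM₁))
  -- near the lower tunnel it is a rotation by `±v`
  obtain ⟨v, hv⟩ := exists_mul_num_eq_one r
  obtain ⟨w'', hw''⟩ := exists_pathLifts_of_isotopic hK hgK hiso c hwc'
  have hlow := mul_eq_r_or (isOpen_lowerSector j) (isOpen_lowerSector (1 - j))
    (smul_mem_lowerSector hv j) (smul_mem_lowerSector hv (1 - j))
    (γ₀ := fun t => complHomeo g hgK (lassoPath e₀ hc₀ β₀ t))
    (γ₁ := fun t => complHomeo g hgK (lassoPath e₁ hc₁ β₁ t))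
    (fun t => (hγ₀ t).2) (fun t => (hγ₁ t).2)
    (x := ((0, y), 1)) (by rw [(lassoPath e₀ hc₀ β₀).source]; exact hgc.symm)
    hyj hyj' (hw'' _ _ hk₀') (hw'' _ _ hk₁')
    (hinvpar (q₀' ▸ hpar' _ hM₀)) (hinvpar (q₁' ▸ hpar' _ hM₁))
  rw [← hprod] at hlow
  refine (num_modEq_of_mul_eq_one hv ?_).elim hr.1 hr.2
  rcases hup with hup | hup <;> rcases hlow with hlow | hlow <;>
    rw [hup, DihedralGroup.r.injEq] at hlow <;> rcases hj with rfl | rfl <;> push_cast at hlow <;>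
    first
      | (left; linear_combination hlow)
      | (left; linear_combination -hlow)
      | (right; linear_combination hlow)
      | (right; linear_combination -hlow)
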